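/- **Model.** Consider an M/M/1 feedback queue with first-come-first-served discipline, arrival rate $\lambda>0$, service rate $\mu>0$ and success probability $0<q\le 1$. After a completed service the customer leaves with probability $q$ (success); otherwise the service has failed and she may go back to the end of the queue or renege. For $x\ge 0$, a customer with threshold $x$ accepts an offered position $i\ge 1$ with probability $u^{(x)}(i)$, where $u^{(x)}(i)=1$ if $i\le\lfloor x\rfloor$, $u^{(x)}(\lfloor x\rfloor+1)=x-\lfloor x\rfloor$, and $u^{(x)}(i)=0$ if $i\ge\lfloor x\rfloor+2$. She uses this rule both on arrival and, independently, after each of her failed services (where the offered position is the last place of the queue, herself included); if she declines, she balks or reneges, respectively. Let $\alpha\ge 0$ be a discount rate and $v\in\mathbb R$ the admission fee (value of the outside option). Suppose that a tagged customer uses threshold $y$ and all other customers use threshold $x$, and that she is in the last position $i$ of a queue of $i$ customers. Let $\widehat W^{(y,x)}_{i,i}$ be the time until she is successfully served or reneges, and put $$\widehat z^{(y,x)}_{i,i}(\alpha)=\mathbb E\big(e^{-\alpha \widehat W^{(y,x)}_{i,i}}\big)-v ,$$ where $e^{-\alpha\widehat W}$ is read as $0$ if $\widehat W=\infty$. A successful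 service brings a reward of $1$; being outside (by balking or by reneging) is worth $v$ at the time when it is chosen; both are discounted at rate $\alpha$. So the expected payoff, relative to balking, of a tagged customer who is offered position $i$ on arrival is $$U_i(y;x)=u^{(y)}(i)\Big(\mathbb E\big(e^{-\alpha\widehat W^{(y,x)}_{i,i}}(\mathbf 1_{\{\text{served}\}}+v\,\mathbf 1_{\{\text{reneged}\}})\big)-v\Big).$$ A threshold $x\ge 0$ is a *Nash equilibrium threshold* if $U_i(y;x)\le U_i(x;x)$ for all $y\ge 0$ and all $i\ge 1$. Let $\mathcal N$ be the set of Nash equilibrium thresholds. **Theorem.** The Nash equilibrium threshold $\widehat x_e$ in the reneging case is given as follows. 1. If $\widehat z^{(1,0)}_{1,1}(\alpha)<0$, then $\widehat x_e=0$, that is, $\mathcal N=\{0\}$. 2. If $\widehat z^{(1,0)}_{1,1}(\alpha)=0$, then $\widehat x_e$ is any number in $[0,1]$: $[0,1]\subseteq\mathcal N$, and $\mathcal N=[0,1]$ if $\alpha>0$. 3. If $m\ge 1$ is an integer with $\widehat z^{(m+1,m)}_{m+1,m+1}(\alpha)\le 0\le \widehat z^{(m,m)}_{m,m}(\alpha)$,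 then $\widehat x_e=m$: $m\in\mathcal N$, and $\mathcal N=\{m\}$ if $\alpha>0$, $q<1$ and $\widehat z^{(1,0)}_{1,1}(\alpha)\ne0$. 4. If $m\ge 1$ is an integer with $\widehat z^{(m+1,m+1)}_{m+1,m+1}(\alpha)<0<\widehat z^{(m+1,m)}_{m+1,m+1}(\alpha)$, then the equation $\widehat z^{(m+1,x)}_{m+1,m+1}(\alpha)=0$ has exactly one root $x=\widehat\chi_m$ in $(m,m+1)$, and $\widehat x_e=\widehat\chi_m$, that is, $\mathcal N=\{\widehat\chi_m\}$. If $\alpha>0$ and $v>0$, at least one of the four cases occurs (in cases 3 and 4 for some $m\ge1$). -/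

import Mathlib

open MeasureTheory ProbabilityTheory
open scoped unitInterval

noncomputable section

/-- The primitives of an M/M/1 queue with feedback: Poisson arrivals of rate `lam`, exponential
services of rate `mu`, and probability `q` that a completed service is successful. -/
structure FeedbackQueue where
  lam : ℝ
  mu : ℝ
  q : ℝ
  lam_pos : 0 < lam
  mu_pos : 0 < mu
  q_pos : 0 < q
  q_le_one : q ≤ 1

/-- The threshold strategy with parameter `x ≥ 0`: the probability of accepting position `i ≥ 1`. -/
def joinProb (x : ℝ) (i : ℕ) : ℝ :=
  if i ≤ ⌊x⌋₊ then 1 else if i = ⌊x⌋₊ + 1 then x - ⌊x⌋₊ else 0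

/-- The situation of the tagged customer: in position `i` of a queue of `j` customers (herself
included, `1 ≤ i ≤ j`), or gone after a successful service, or gone by reneging. -/
inductive TaggedState where
  | inQueue (i j : ℕ)
  | served
  | reneged

instance : MeasurableSpace TaggedState := ⊤

def TaggedState.IsGone : TaggedState → Prop
  | .inQueue _ _ => False
  | .served => True
  | .reneged => True

/-- The randomness of one event of the uniformised queue: the time since the previous event, and
three independent uniform variables that decide whether the event is an arrival or a service
completion, whether a service is successful, and the (re)joining decision of the customer who has
to take one. -/
abbrev Mark : Type := ℝ × I × I × I

namespace FeedbackQueue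

variable (Q : FeedbackQueue)

/-- Events occur at rate `lam + mu`. -/
def markLaw : Measure Mark :=
  (expMeasure (Q.lam + Q.mu)).prod
    ((volume : Measure I).prod ((volume : Measure I).prod (volume : Measure I)))

instance isProbabilityMeasure_markLaw : IsProbabilityMeasure Q.markLaw := by
  have : IsProbabilityMeasure (expMeasure (Q.lam + Q.mu)) :=
    isProbabilityMeasure_expMeasure (add_pos Q.lam_pos Q.mu_pos)
  unfold markLaw
  infer_instance

/-- The marks of the successive events are independent. -/
def pathLaw : Measure (ℕ → Mark) :=
  Measure.infinitePi (fun _ : ℕ => Q.markLaw)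

open Classical in
/-- The effect of one event when the tagged customer uses threshold `y` and all others use
threshold `x`. An arrival finds `j` customers and accepts position `j + 1` with probability
`joinProb x (j + 1)`. If a service fails, the served customer would go back to position `j`; she
accepts it with the probability prescribed by her threshold and reneges otherwise. -/
def step (y x : ℝ) (ω : Mark) : TaggedState → TaggedState
  | .inQueue i j =>
      if (ω.2.1 : ℝ) < Q.lam / (Q.lam + Q.mu) then
        if (ω.2.2.2 : ℝ) < joinProb x (j + 1) then .inQueue i (j + 1) else .inQueue i j
      else if i = 1 then
        if (ω.2.2.1 : ℝ) < Q.q then .served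
        else if (ω.2.2.2 : ℝ) < joinProb y j then .inQueue j j
        else .reneged
      else
        if (ω.2.2.1 : ℝ) < Q.q then .inQueue (i - 1) (j - 1)
        else if (ω.2.2.2 : ℝ) < joinProb x j then .inQueue (i - 1) j
        else .inQueue (i - 1) (j - 1)
  | .served => .served
  | .reneged => .reneged

/-- The state of the tagged customer after `n` events, when she starts in state `s`. -/
def chain (y x : ℝ) (s : TaggedState) (ω : ℕ → Mark) : ℕ → TaggedState
  | 0 => s
  | n + 1 => Q.step y x (ω n) (chain y x s ω n)

/-- The time the tagged customer spends in the system, until she is successfully served or reneges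
(meaningful only if she eventually leaves). -/
def sojournTime (y x : ℝ) (s : TaggedState) (ω : ℕ → Mark) : ℝ :=
  ∑ k ∈ Finset.range (sInf {n : ℕ | (Q.chain y x s ω n).IsGone}), (ω k).1

open Classical in
/-- A unit of reward at a successful service, an amount `c` at reneging, both discounted at rate
`α` over the sojourn time; nothing if the tagged customer never leaves. -/
def discountedReward (α c y x : ℝ) (s : TaggedState) (ω : ℕ → Mark) : ℝ :=
  if ∃ n, Q.chain y x s ω n = .served then Real.exp (-α * Q.sojournTime y x s ω)
  else if ∃ n, Q.chain y x s ω n = .reneged then c * Real.exp (-α * Q.sojournTime y x s ω)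
  else 0

/-- `E[exp (-α W)] - v`, where `W` is the time until the tagged customer is successfully served or
reneges, for a tagged customer with threshold `y` who starts in position `i` of a queue of `i`
customers, all others using threshold `x` (with `exp (-α W) = 0` when `W` is infinite). -/
def zHat (α v y x : ℝ) (i : ℕ) : ℝ :=
  (∫ ω, Q.discountedReward α 1 y x (.inQueue i i) ω ∂Q.pathLaw) - v

/-- The expected payoff, relative to balking, of a tagged customer with threshold `y` who can take
position `i` on arrival, all others using threshold `x`. Staying out of the system, by balking or
by reneging, is worth the outside option `v` at the time at which it is chosen. -/
def payoff (α v y x : ℝ) (i : ℕ) : ℝ :=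
  joinProb y i * ((∫ ω, Q.discountedReward α v y x (.inQueue i i) ω ∂Q.pathLaw) - v)

/-- Threshold `x` is a symmetric Nash equilibrium: if all others use `x`, then no threshold gives
the tagged customer more than `x` does, whatever position she is offered on arrival. -/
def IsNashThreshold (α v x : ℝ) : Prop :=
  0 ≤ x ∧ ∀ i : ℕ, 1 ≤ i → ∀ y : ℝ, 0 ≤ y → Q.payoff α v y x i ≤ Q.payoff α v x x i

end FeedbackQueue

end

/-! Conditioning on the first event turns the expected reward into a solution of the linear
recursion `valueStep` in (position, queue length) (`expectedReward_inQueue`). Nobody accepts a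
position above ⌊x⌋ + 1, so the recursion lives on a finite triangle, and for α > 0 it contracts:
subsolutions lie below supersolutions (`sub_le_of_valueStep`).

Everything then reduces to one function, G_x(i, j) = `rejoinReward`, the value of never reneging.
When a customer's integer threshold N is at least x, the queue cannot outgrow what she accepts, so
`zHat` at N is G_x(N, N) - v (`zHat_nat`). Since G_x(j, j) decreases in j, a best reply stays
exactly where G_x(j, j) is above v, with indifference at equality. Hence x > 0 is an equilibrium iff
G_x(⌊x⌋+1, ⌊x⌋+1) ≤ v ≤ G_x(⌈x⌉, ⌈x⌉) (`isNashThreshold_of_rejoinReward`,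
`rejoinReward_le_of_isNashThreshold`, `le_rejoinReward_of_isNashThreshold`).

Crowding hurts: G_x is continuous and decreasing in x, and G_x(n+1, n+1) is strictly decreasing on
[n, n+1] when n ≥ 1 and q < 1. This gives uniqueness (`exists_of_isNashThreshold_lt`) and the mixed
root by the intermediate value theorem. The exceptions are genuine: G_x(1, 1) is constant for x in
[0, 1], which produces the interval of equilibria, and G_x does not depend on x if q = 1. Coverage
follows from the geometric decay of G_x(j, j) and the choice of the least m at which joining behind
m others is unprofitable.

For α = 0 there is no contraction, but the customer leaves almost surely, so `zHat` is 1 - v and the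
cases are settled by comparing v with 1. -/

/-! ### Integrals over a single mark, and the shift of an i.i.d. sequence. -/

lemma integral_ite_lt_unitInterval {a : ℝ} (h0 : 0 ≤ a) (h1 : a ≤ 1) (X Y : ℝ) :
    ∫ u : I, (if (u : ℝ) < a then X else Y) = a * X + (1 - a) * Y := by
  have hs : MeasurableSet {u : I | (u : ℝ) < a} :=
    measurableSet_lt measurable_subtype_coe measurable_const
  have hset : {u : I | (u : ℝ) < a} = Set.Iio (⟨a, h0, h1⟩ : I) := by
    ext u; simp [← Subtype.coe_lt_coe]
  have hμ : (volume : Measure I).real {u : I | (u : ℝ) < a} = a := by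
    rw [hset, Measure.real, unitInterval.volume_Iio, ENNReal.toReal_ofReal h0]
  have hfun : (fun u : I => if (u : ℝ) < a then X else Y) =
      fun u => Y + Set.indicator {u : I | (u : ℝ) < a} (fun _ => X - Y) u := by
    funext u
    by_cases hu : (u : ℝ) < a <;> simp [Set.indicator, hu]
  rw [hfun, integral_add (integrable_const _) ((integrable_const _).indicator hs),
    integral_indicator hs]
  simp [hμ]
  ring

lemma ae_nonneg_expMeasure (r : ℝ) : ∀ᵐ t ∂expMeasure r, 0 ≤ t := by
  have : expMeasure r (Set.Iio 0) = 0 := by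
    rw [expMeasure, gammaMeasure, withDensity_apply _ measurableSet_Iio]
    exact lintegral_gammaPDF_of_nonpos le_rfl
  rw [ae_iff]
  simpa [Set.Iio] using this

lemma integral_exp_neg_mul_expMeasure {r α : ℝ} (hr : 0 < r) (hα : 0 ≤ α) :
    ∫ t, Real.exp (-α * t) ∂expMeasure r = r / (r + α) := by
  have hra : 0 < r + α := by linarith
  rw [expMeasure, gammaMeasure]
  have hd : gammaPDF 1 r = fun x => ENNReal.ofReal (gammaPDFReal 1 r x) := rfl
  rw [hd, integral_withDensity_eq_integral_toReal_smul
    (measurable_gammaPDFReal 1 r).ennreal_ofReal (by simp)]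
  have h : ∀ x : ℝ, (ENNReal.ofReal (gammaPDFReal 1 r x)).toReal • Real.exp (-α * x) =
      Set.indicator (Set.Ici 0) (fun x => r * Real.exp (-(r + α) * x)) x := by
    intro x
    rw [ENNReal.toReal_ofReal (gammaPDFReal_nonneg one_pos hr x)]
    by_cases hx : 0 ≤ x
    · simp only [gammaPDFReal, hx, if_true, Set.indicator, Set.mem_Ici, smul_eq_mul]
      rw [Real.Gamma_one]
      simp only [Real.rpow_one, div_one, sub_self, Real.rpow_zero, mul_one]
      rw [mul_assoc, ← Real.exp_add]
      ring_nf
    · simp [gammaPDFReal, hx, Set.indicator]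
  simp_rw [h]
  rw [integral_indicator measurableSet_Ici, integral_Ici_eq_integral_Ioi, integral_const_mul,
    integral_exp_mul_Ioi (by linarith)]
  rw [mul_zero, Real.exp_zero, neg_div_neg_eq, mul_one_div]

/-- Prepending a value to a sequence. -/
def seqCons {X : Type*} (z : X × (ℕ → X)) : ℕ → X
  | 0 => z.1
  | n + 1 => z.2 n

lemma measurable_seqCons {X : Type*} [MeasurableSpace X] :
    Measurable (seqCons : X × (ℕ → X) → ℕ → X) := by
  refine measurable_pi_lambda _ fun n => ?_
  cases n with
  | zero => exact measurable_fst
  | succ n => exact (measurable_pi_apply n).comp measurable_snd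

/-- This is what allows the first event to be split off from the path law, leaving an independent
path with the same law. -/
lemma map_seqCons_infinitePi {X : Type*} [MeasurableSpace X] (μ : Measure X)
    [IsProbabilityMeasure μ] :
    (μ.prod (Measure.infinitePi fun _ : ℕ => μ)).map seqCons =
      Measure.infinitePi fun _ : ℕ => μ := by
  classical
  refine Measure.eq_infinitePi _ fun s t ht => ?_
  obtain ⟨n, hn⟩ : ∃ n, s ⊆ Finset.range (n + 1) := by
    refine ⟨s.sup id, fun i hi => ?_⟩
    exact Finset.mem_range.2 (Nat.lt_succ_of_le (Finset.le_sup (f := id) hi))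
  -- Padding the cylinder with `Set.univ` makes it depend on an initial segment, from which
  -- coordinate 0 can be peeled off.
  set t' : ℕ → Set X := fun i => if i ∈ s then t i else Set.univ with ht'
  have mt' : ∀ i, MeasurableSet (t' i) := by
    intro i
    by_cases hi : i ∈ s <;> simp [ht', hi, ht]
  have hpi : Set.pi (s : Set ℕ) t = Set.pi (Finset.range (n + 1) : Set ℕ) t' := by
    ext f
    simp only [Set.mem_pi, Finset.mem_coe]
    refine ⟨fun h i _ => ?_, fun h i hi => ?_⟩
    · by_cases hi : i ∈ s
      · simpa [ht', hi] using h i hi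
      · simp [ht', hi]
    · simpa [ht', hi] using h i (hn hi)
  have hprod : ∏ i ∈ s, μ (t i) = ∏ i ∈ Finset.range (n + 1), μ (t' i) := by
    rw [← Finset.prod_subset hn (f := fun i => μ (t' i))]
    · exact Finset.prod_congr rfl fun i hi => by simp [ht', hi]
    · intro i _ hi
      simp [ht', hi]
  have hpre : seqCons ⁻¹' (Set.pi (Finset.range (n + 1) : Set ℕ) t') =
      t' 0 ×ˢ Set.pi (Finset.range n : Set ℕ) (fun i => t' (i + 1)) := by
    ext ⟨a, f⟩
    simp only [Set.mem_preimage, Set.mem_pi, Set.mem_prod, Finset.mem_coe, Finset.mem_range]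
    refine ⟨fun h => ⟨h 0 (by omega), fun i hi => h (i + 1) (by omega)⟩, ?_⟩
    rintro ⟨h0, h1⟩ (_ | i) hi
    · exact h0
    · exact h1 i (by omega)
  rw [hpi, hprod, Measure.map_apply measurable_seqCons
    (.pi (Finset.countable_toSet _) fun i _ => mt' i), hpre, Measure.prod_prod,
    Measure.infinitePi_pi _ fun i _ => mt' (i + 1), Finset.prod_range_succ', mul_comm]

lemma joinProb_nonneg {x : ℝ} (hx : 0 ≤ x) (i : ℕ) : 0 ≤ joinProb x i := by
  unfold joinProb
  split_ifs
  · exact zero_le_one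
  · linarith [Nat.floor_le hx]
  · exact le_rfl

lemma joinProb_le_one (x : ℝ) (i : ℕ) : joinProb x i ≤ 1 := by
  unfold joinProb
  split_ifs
  · exact le_rfl
  · linarith [Nat.lt_floor_add_one x]
  · exact zero_le_one

namespace TaggedState

/-- Tagged states as an optional pair of positions or a flag. -/
def toSum : TaggedState → (ℕ × ℕ) ⊕ Bool
  | inQueue i j => .inl (i, j)
  | served => .inr true
  | reneged => .inr false

lemma toSum_injective : Function.Injective toSum := by
  intro a b h
  cases a <;> cases b <;> simp_all [toSum]

instance : Countable TaggedState := toSum_injective.countable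

instance : DiscreteMeasurableSpace TaggedState := ⟨fun _ => trivial⟩

end TaggedState

/-! ### Measurability of the reward and first-step analysis. -/

namespace FeedbackQueue

variable (Q : FeedbackQueue)

lemma measurable_step (y x : ℝ) (s : TaggedState) : Measurable fun m : Mark => Q.step y x m s := by
  have h1 (a : ℝ) : MeasurableSet {m : Mark | (m.2.1 : ℝ) < a} :=
    measurableSet_lt (by fun_prop) measurable_const
  have h2 (a : ℝ) : MeasurableSet {m : Mark | (m.2.2.1 : ℝ) < a} :=
    measurableSet_lt (by fun_prop) measurable_const
  have h3 (a : ℝ) : MeasurableSet {m : Mark | (m.2.2.2 : ℝ) < a} :=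
    measurableSet_lt (by fun_prop) measurable_const
  cases s with
  | inQueue i j =>
    simp only [step]
    refine Measurable.ite (h1 _) (Measurable.ite (h3 _) measurable_const measurable_const) ?_
    by_cases hi : i = 1
    · simp only [hi, if_true]
      exact Measurable.ite (h2 _) measurable_const
        (Measurable.ite (h3 _) measurable_const measurable_const)
    · simp only [hi, if_false]
      exact Measurable.ite (h2 _) measurable_const
        (Measurable.ite (h3 _) measurable_const measurable_const)
  | served => exact measurable_const
  | reneged => exact measurable_const

lemma measurable_chain (y x : ℝ) (s : TaggedState) (n : ℕ) :
    Measurable fun ω : ℕ → Mark => Q.chain y x s ω n := by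
  induction n with
  | zero => exact measurable_const
  | succ n ih =>
    have : Measurable fun z : Mark × TaggedState => Q.step y x z.1 z.2 :=
      measurable_from_prod_countable_left fun s => Q.measurable_step y x s
    exact this.comp ((measurable_pi_apply n).prodMk ih)

lemma measurableSet_chain (y x : ℝ) (s : TaggedState) (n : ℕ) (A : Set TaggedState) :
    MeasurableSet {ω : ℕ → Mark | Q.chain y x s ω n ∈ A} :=
  Q.measurable_chain y x s n (MeasurableSet.of_discrete)

/-- The number of events until the tagged customer is gone. -/
noncomputable def exitIndex (y x : ℝ) (s : TaggedState) (ω : ℕ → Mark) : ℕ :=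
  sInf {n : ℕ | (Q.chain y x s ω n).IsGone}

lemma measurable_exitIndex (y x : ℝ) (s : TaggedState) : Measurable (Q.exitIndex y x s) := by
  refine measurable_to_countable' fun k => ?_
  -- The last set collects the paths that never exit: there the infimum of the empty set is 0.
  have hset : Q.exitIndex y x s ⁻¹' {k} =
      ({ω | Q.chain y x s ω k ∈ {t | t.IsGone}} ∩
        ⋂ m : ℕ, ⋂ _ : m < k, {ω | Q.chain y x s ω m ∈ {t | t.IsGone}}ᶜ) ∪
      {ω | k = 0 ∧ ∀ m : ℕ, ω ∈ {ω | Q.chain y x s ω m ∈ {t | t.IsGone}}ᶜ} := by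
    ext ω
    simp only [Set.mem_preimage, Set.mem_singleton_iff, exitIndex, Set.mem_union, Set.mem_inter_iff,
      Set.mem_iInter, Set.mem_compl_iff, Set.mem_ofPred_eq]
    constructor
    · rintro rfl
      by_cases hne : ∃ n, (Q.chain y x s ω n).IsGone
      · exact Or.inl ⟨Nat.sInf_mem hne, fun m hm => Nat.notMem_of_lt_sInf hm⟩
      · push Not at hne
        refine Or.inr ⟨?_, hne⟩
        rw [Nat.sInf_eq_zero]
        exact Or.inr (Set.eq_empty_of_forall_notMem hne)
    · rintro (⟨h1, h2⟩ | ⟨rfl, h2⟩)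
      · refine le_antisymm (Nat.sInf_le h1) ?_
        by_contra! hlt
        exact h2 _ hlt (Nat.sInf_mem (s := {n | (Q.chain y x s ω n).IsGone}) ⟨k, h1⟩)
      · rw [Nat.sInf_eq_zero]
        exact Or.inr (Set.eq_empty_of_forall_notMem h2)
  rw [hset]
  refine ((Q.measurableSet_chain ..).inter
    (.iInter fun m => .iInter fun _ => (Q.measurableSet_chain ..).compl)).union ?_
  by_cases hk : k = 0
  · simp only [hk, true_and]
    rw [Set.ofPred_forall]
    exact .iInter fun m => (Q.measurableSet_chain ..).compl
  · simp [hk]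

lemma measurable_sojournTime (y x : ℝ) (s : TaggedState) : Measurable (Q.sojournTime y x s) := by
  have : Measurable fun z : (ℕ → Mark) × ℕ => ∑ k ∈ Finset.range z.2, (z.1 k).1 := by
    refine measurable_from_prod_countable_left fun n => ?_
    change Measurable fun ω : ℕ → Mark => ∑ k ∈ Finset.range n, (ω k).1
    exact Finset.measurable_fun_sum _ fun k _ =>
      Measurable.fst (measurable_pi_apply (X := fun _ : ℕ => Mark) k)
  exact this.comp (measurable_id.prodMk (Q.measurable_exitIndex y x s))

lemma measurable_discountedReward (α c y x : ℝ) (s : TaggedState) :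
    Measurable (Q.discountedReward α c y x s) := by
  have hex (a : TaggedState) : MeasurableSet {ω : ℕ → Mark | ∃ n, Q.chain y x s ω n = a} := by
    rw [Set.ofPred_exists]
    exact .iUnion fun n => Q.measurableSet_chain y x s n {a}
  have hexp : Measurable fun ω => Real.exp (-α * Q.sojournTime y x s ω) :=
    Real.measurable_exp.comp ((Q.measurable_sojournTime y x s).const_mul _)
  unfold discountedReward
  exact Measurable.ite (hex _) hexp (Measurable.ite (hex _) (hexp.const_mul c) measurable_const)

lemma chain_seqCons (y x : ℝ) (s : TaggedState) (m : Mark) (ω : ℕ → Mark) (n : ℕ) :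
    Q.chain y x s (seqCons (m, ω)) (n + 1) = Q.chain y x (Q.step y x m s) ω n := by
  induction n with
  | zero => rfl
  | succ n ih =>
    rw [chain, ih]
    rfl

lemma chain_served (y x : ℝ) (ω : ℕ → Mark) (n : ℕ) : Q.chain y x .served ω n = .served := by
  induction n with
  | zero => rfl
  | succ n ih => rw [chain, ih]; rfl

lemma chain_reneged (y x : ℝ) (ω : ℕ → Mark) (n : ℕ) : Q.chain y x .reneged ω n = .reneged := by
  induction n with
  | zero => rfl
  | succ n ih => rw [chain, ih]; rfl

lemma discountedReward_served (α c y x : ℝ) (ω : ℕ → Mark) :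
    Q.discountedReward α c y x .served ω = 1 := by
  have h : sInf {n : ℕ | (Q.chain y x .served ω n).IsGone} = 0 :=
    Nat.sInf_eq_zero.2 (Or.inl trivial)
  simp only [discountedReward, sojournTime, h]
  simp [chain_served]

lemma discountedReward_reneged (α c y x : ℝ) (ω : ℕ → Mark) :
    Q.discountedReward α c y x .reneged ω = c := by
  have h : sInf {n : ℕ | (Q.chain y x .reneged ω n).IsGone} = 0 :=
    Nat.sInf_eq_zero.2 (Or.inl trivial)
  simp only [discountedReward, sojournTime, h]
  simp [chain_reneged]

lemma isGone_iff (s : TaggedState) : s.IsGone ↔ s = .served ∨ s = .reneged := by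
  cases s <;> simp [TaggedState.IsGone]

/-- Pathwise Markov property: the first event multiplies the reward by its own discount factor, and
the rest is the reward of the shifted path from the new state. -/
lemma discountedReward_seqCons (α c y x : ℝ) (i j : ℕ) (m : Mark) (ω : ℕ → Mark) :
    Q.discountedReward α c y x (.inQueue i j) (seqCons (m, ω)) =
      Real.exp (-α * m.1) * Q.discountedReward α c y x (Q.step y x m (.inQueue i j)) ω := by
  set s' := Q.step y x m (.inQueue i j) with hs'
  have hex (a : TaggedState) (ha : a ≠ .inQueue i j) :
      (∃ n, Q.chain y x (.inQueue i j) (seqCons (m, ω)) n = a) ↔ ∃ n, Q.chain y x s' ω n = a := by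
    constructor
    · rintro ⟨n, hn⟩
      cases n with
      | zero => exact absurd hn.symm ha
      | succ n => exact ⟨n, by rw [← hn, chain_seqCons]⟩
    · rintro ⟨n, hn⟩
      exact ⟨n + 1, by rw [chain_seqCons, hn]⟩
  -- Exit must occur here: otherwise both exit indices default to 0 and the shift by one fails.
  -- Paths without exit earn 0 on both sides.
  have htime (hg : ∃ n, (Q.chain y x s' ω n).IsGone) :
      Q.sojournTime y x (.inQueue i j) (seqCons (m, ω)) = m.1 + Q.sojournTime y x s' ω := by
    have hinf : sInf {n : ℕ | (Q.chain y x (.inQueue i j) (seqCons (m, ω)) n).IsGone} =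
        sInf {n : ℕ | (Q.chain y x s' ω n).IsGone} + 1 := by
      obtain ⟨n, hn⟩ := hg
      have hpos : 0 < sInf {n : ℕ | (Q.chain y x (.inQueue i j) (seqCons (m, ω)) n).IsGone} := by
        rw [Nat.pos_iff_ne_zero, Ne, Nat.sInf_eq_zero, not_or]
        refine ⟨fun h => h, Set.Nonempty.ne_empty ⟨n + 1, ?_⟩⟩
        rw [Set.mem_ofPred_eq, chain_seqCons]
        exact hn
      rw [← Nat.sInf_add (p := fun n =>
        (Q.chain y x (.inQueue i j) (seqCons (m, ω)) n).IsGone) (n := 1) hpos]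
      simp only [chain_seqCons, ← hs']
    rw [sojournTime, hinf, Finset.sum_range_succ', add_comm]
    rfl
  unfold discountedReward
  by_cases h1 : ∃ n, Q.chain y x s' ω n = .served
  · obtain ⟨n, hn⟩ := h1
    rw [if_pos ((hex _ (by simp)).2 ⟨n, hn⟩), if_pos ⟨n, hn⟩,
      htime ⟨n, (isGone_iff _).2 (Or.inl hn)⟩, mul_add, Real.exp_add]
  · rw [if_neg (mt (hex _ (by simp)).1 h1), if_neg h1]
    by_cases h2 : ∃ n, Q.chain y x s' ω n = .reneged
    · obtain ⟨n, hn⟩ := h2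
      rw [if_pos ((hex _ (by simp)).2 ⟨n, hn⟩), if_pos ⟨n, hn⟩,
        htime ⟨n, (isGone_iff _).2 (Or.inr hn)⟩, mul_add, Real.exp_add]
      ring
    · rw [if_neg (mt (hex _ (by simp)).1 h2), if_neg h2, mul_zero]

instance isProbabilityMeasure_pathLaw : IsProbabilityMeasure Q.pathLaw := by
  unfold pathLaw
  infer_instance

lemma ae_pathLaw_time_nonneg : ∀ᵐ ω ∂Q.pathLaw, ∀ k, 0 ≤ (ω k).1 := by
  rw [ae_all_iff]
  intro k
  have h1 : ∀ᵐ m ∂Q.markLaw, 0 ≤ m.1 :=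
    Measure.quasiMeasurePreserving_fst.ae (ae_nonneg_expMeasure (Q.lam + Q.mu))
  exact (measurePreserving_eval_infinitePi (fun _ : ℕ => Q.markLaw) k).quasiMeasurePreserving.ae h1

lemma exp_sojournTime_le_one {α : ℝ} (hα : 0 ≤ α) (y x : ℝ) (s : TaggedState) {ω : ℕ → Mark}
    (hω : ∀ k, 0 ≤ (ω k).1) : Real.exp (-α * Q.sojournTime y x s ω) ≤ 1 := by
  rw [Real.exp_le_one_iff]
  have : 0 ≤ Q.sojournTime y x s ω := Finset.sum_nonneg fun k _ => hω k
  nlinarith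

lemma discountedReward_mem {α c : ℝ} (hα : 0 ≤ α) (hc : 0 ≤ c) (y x : ℝ) (s : TaggedState)
    {ω : ℕ → Mark} (hω : ∀ k, 0 ≤ (ω k).1) :
    0 ≤ Q.discountedReward α c y x s ω ∧ Q.discountedReward α c y x s ω ≤ max 1 c := by
  have h1 := Q.exp_sojournTime_le_one hα y x s hω
  have h0 := (Real.exp_pos (-α * Q.sojournTime y x s ω)).le
  unfold discountedReward
  split_ifs
  · exact ⟨h0, h1.trans (le_max_left _ _)⟩
  · exact ⟨mul_nonneg hc h0, (mul_le_of_le_one_right hc h1).trans (le_max_right _ _)⟩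
  · exact ⟨le_rfl, le_max_of_le_left zero_le_one⟩

lemma integrable_discountedReward {α c : ℝ} (hα : 0 ≤ α) (hc : 0 ≤ c) (y x : ℝ)
    (s : TaggedState) : Integrable (Q.discountedReward α c y x s) Q.pathLaw := by
  refine Integrable.of_bound (Q.measurable_discountedReward α c y x s).aestronglyMeasurable
    (max 1 c) ?_
  filter_upwards [Q.ae_pathLaw_time_nonneg] with ω hω
  obtain ⟨h0, h1⟩ := Q.discountedReward_mem hα hc y x s hω
  rwa [Real.norm_of_nonneg h0]

/-- The expected discounted reward. -/
noncomputable def expectedReward (α c y x : ℝ) (s : TaggedState) : ℝ :=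
  ∫ ω, Q.discountedReward α c y x s ω ∂Q.pathLaw

lemma expectedReward_nonneg {α c : ℝ} (hα : 0 ≤ α) (hc : 0 ≤ c) (y x : ℝ) (s : TaggedState) :
    0 ≤ Q.expectedReward α c y x s := by
  refine integral_nonneg_of_ae ?_
  filter_upwards [Q.ae_pathLaw_time_nonneg] with ω hω
  exact (Q.discountedReward_mem hα hc y x s hω).1

lemma expectedReward_le {α c : ℝ} (hα : 0 ≤ α) (hc : 0 ≤ c) (y x : ℝ) (s : TaggedState) :
    Q.expectedReward α c y x s ≤ max 1 c := by
  have : Q.expectedReward α c y x s ≤ ∫ _, max 1 c ∂Q.pathLaw := by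
    refine integral_mono_ae (Q.integrable_discountedReward hα hc y x s) (integrable_const _) ?_
    filter_upwards [Q.ae_pathLaw_time_nonneg] with ω hω
    exact (Q.discountedReward_mem hα hc y x s hω).2
  simpa using this

lemma expectedReward_served (α c y x : ℝ) : Q.expectedReward α c y x .served = 1 := by
  simp [expectedReward, discountedReward_served]

lemma expectedReward_reneged (α c y x : ℝ) : Q.expectedReward α c y x .reneged = c := by
  simp [expectedReward, discountedReward_reneged]

lemma expectedReward_inQueue_eq_integral {α c : ℝ} (hα : 0 ≤ α) (hc : 0 ≤ c) (y x : ℝ)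
    (i j : ℕ) : Q.expectedReward α c y x (.inQueue i j) =
      ∫ m, Real.exp (-α * m.1) * Q.expectedReward α c y x (Q.step y x m (.inQueue i j))
        ∂Q.markLaw := by
  have hmap : (Q.markLaw.prod Q.pathLaw).map seqCons = Q.pathLaw :=
    map_seqCons_infinitePi Q.markLaw
  have hint := Q.integrable_discountedReward hα hc y x (.inQueue i j)
  have hmeas := (Q.measurable_discountedReward α c y x (.inQueue i j))
  rw [← hmap] at hint
  rw [integrable_map_measure hmeas.aestronglyMeasurable measurable_seqCons.aemeasurable] at hint
  rw [expectedReward, ← hmap, integral_map measurable_seqCons.aemeasurable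
    hmeas.aestronglyMeasurable]
  have h := integral_prod _ hint
  simp only [Function.comp_def] at h
  rw [h]
  refine integral_congr_ae (Filter.Eventually.of_forall fun m => ?_)
  simp only [discountedReward_seqCons, integral_const_mul]
  rfl

end FeedbackQueue

/-! ### The value recursion and its link with the queue. -/

/-- One step of the value recursion of a tagged customer in position `i` of a queue of `j`
customers, with values `g` elsewhere in the queue, a reward `1` for a successful service and a
continuation value `e j` after a failed one: `b` is the discount factor per event, `p` the
probability that an event is an arrival, `q` the success probability, and `r` the probabilities
with which the other customers accept the positions. -/
noncomputable def valueStep (b p q : ℝ) (r e : ℕ → ℝ) (g : ℕ → ℕ → ℝ) (i j : ℕ) : ℝ :=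
  b * (p * (r (j + 1) * g i (j + 1) + (1 - r (j + 1)) * g i j) +
    (1 - p) * (if i = 1 then q + (1 - q) * e j
      else q * g (i - 1) (j - 1) +
        (1 - q) * (r j * g (i - 1) j + (1 - r j) * g (i - 1) (j - 1))))

/-- One shape serves both kinds of event in `step`. Equal values C = D cover a success, where the
third uniform variable plays no role. -/
lemma integral_ite_prod {a b c d e : ℝ} (ha : 0 ≤ a ∧ a ≤ 1) (hb : 0 ≤ b ∧ b ≤ 1)
    (hc : 0 ≤ c ∧ c ≤ 1) (hd : 0 ≤ d ∧ d ≤ 1) (he : 0 ≤ e ∧ e ≤ 1) (A B C D E F : ℝ) :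
    ∫ u : I × I × I, (if (u.1 : ℝ) < a then (if (u.2.2 : ℝ) < c then A else B)
      else if (u.2.1 : ℝ) < b then (if (u.2.2 : ℝ) < d then C else D)
      else if (u.2.2 : ℝ) < e then E else F) =
    a * (c * A + (1 - c) * B) + (1 - a) * (b * (d * C + (1 - d) * D) +
      (1 - b) * (e * E + (1 - e) * F)) := by
  have h1 (a : ℝ) : MeasurableSet {m : I × I × I | (m.1 : ℝ) < a} :=
    measurableSet_lt (by fun_prop) measurable_const
  have h2 (a : ℝ) : MeasurableSet {m : I × I × I | (m.2.1 : ℝ) < a} :=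
    measurableSet_lt (by fun_prop) measurable_const
  have h3 (a : ℝ) : MeasurableSet {m : I × I × I | (m.2.2 : ℝ) < a} :=
    measurableSet_lt (by fun_prop) measurable_const
  set f : I × I × I → ℝ := fun u => (if (u.1 : ℝ) < a then (if (u.2.2 : ℝ) < c then A else B)
      else if (u.2.1 : ℝ) < b then (if (u.2.2 : ℝ) < d then C else D)
      else if (u.2.2 : ℝ) < e then E else F) with hf
  have hmeas : Measurable f :=
    Measurable.ite (h1 _) (Measurable.ite (h3 _) measurable_const measurable_const)
      (Measurable.ite (h2 _) (Measurable.ite (h3 _) measurable_const measurable_const)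
        (Measurable.ite (h3 _) measurable_const measurable_const))
  have hbd : ∀ u, ‖f u‖ ≤ |A| + |B| + |C| + |D| + |E| + |F| := by
    intro u
    simp only [hf, Real.norm_eq_abs]
    have := abs_nonneg A
    have := abs_nonneg B
    have := abs_nonneg C
    have := abs_nonneg D
    have := abs_nonneg E
    have := abs_nonneg F
    split_ifs <;> linarith
  have hint : Integrable f (volume.prod (volume.prod volume)) :=
    Integrable.of_bound hmeas.aestronglyMeasurable _ (Filter.Eventually.of_forall hbd)
  have hint2 (u : I) : Integrable (fun w => f (u, w)) (volume.prod volume) :=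
    Integrable.of_bound (hmeas.comp measurable_prodMk_left).aestronglyMeasurable _
      (Filter.Eventually.of_forall fun w => hbd (u, w))
  change ∫ u, f u ∂(volume.prod (volume.prod volume)) = _
  rw [integral_prod _ hint]
  have hin (u : I) : ∫ w, f (u, w) ∂(volume.prod volume) =
      if (u : ℝ) < a then c * A + (1 - c) * B else b * (d * C + (1 - d) * D) +
        (1 - b) * (e * E + (1 - e) * F) := by
    rw [integral_prod _ (hint2 u)]
    by_cases hu : (u : ℝ) < a
    · simp only [hf, hu, if_true, integral_ite_lt_unitInterval hc.1 hc.2]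
      simp
    · have hin2 (w : I) : ∫ z : I, f (u, w, z) =
          if (w : ℝ) < b then d * C + (1 - d) * D else e * E + (1 - e) * F := by
        by_cases hw : (w : ℝ) < b
        · simp only [hf, hu, hw, if_true, if_false, integral_ite_lt_unitInterval hd.1 hd.2]
        · simp only [hf, hu, hw, if_false, integral_ite_lt_unitInterval he.1 he.2]
      simp only [hin2, hu, if_false, integral_ite_lt_unitInterval hb.1 hb.2]
  simp only [hin, integral_ite_lt_unitInterval ha.1 ha.2]

namespace FeedbackQueue

variable (Q : FeedbackQueue)

/-- The probability that an event of the uniformised queue is an arrival. -/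
noncomputable def arrivalProb : ℝ := Q.lam / (Q.lam + Q.mu)

/-- The mean discount factor of the time between two events. -/
noncomputable def eventDiscount (α : ℝ) : ℝ := (Q.lam + Q.mu) / (Q.lam + Q.mu + α)

lemma arrivalProb_pos : 0 < Q.arrivalProb := div_pos Q.lam_pos (add_pos Q.lam_pos Q.mu_pos)

lemma arrivalProb_lt_one : Q.arrivalProb < 1 := by
  rw [arrivalProb, div_lt_one (add_pos Q.lam_pos Q.mu_pos)]
  linarith [Q.mu_pos]

/-- The new state ignores the elapsed time, so the integral over the first mark factors into the
mean discount and the average over the three uniform variables. The customer's own threshold enters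
only through the continuation value after a failed service. -/
lemma expectedReward_inQueue {α c y x : ℝ} (hα : 0 ≤ α) (hc : 0 ≤ c) (hy : 0 ≤ y) (hx : 0 ≤ x)
    (i j : ℕ) : Q.expectedReward α c y x (.inQueue i j) =
      valueStep (Q.eventDiscount α) Q.arrivalProb Q.q (joinProb x)
        (fun k => joinProb y k * Q.expectedReward α c y x (.inQueue k k) + (1 - joinProb y k) * c)
        (fun k l => Q.expectedReward α c y x (.inQueue k l)) i j := by
  set F := Q.expectedReward α c y x with hF
  have hstep (m : Mark) : Q.step y x m (.inQueue i j) = Q.step y x (0, m.2) (.inQueue i j) := rfl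
  have hp := And.intro Q.arrivalProb_pos.le Q.arrivalProb_lt_one.le
  have hq := And.intro Q.q_pos.le Q.q_le_one
  have hrx (k : ℕ) := And.intro (joinProb_nonneg hx k) (joinProb_le_one x k)
  have hry (k : ℕ) := And.intro (joinProb_nonneg hy k) (joinProb_le_one y k)
  rw [hF, Q.expectedReward_inQueue_eq_integral hα hc, ← hF]
  simp_rw [hstep]
  have : IsProbabilityMeasure (expMeasure (Q.lam + Q.mu)) :=
    isProbabilityMeasure_expMeasure (add_pos Q.lam_pos Q.mu_pos)
  rw [markLaw, integral_prod_mul (fun t : ℝ => Real.exp (-α * t))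
    (fun u => F (Q.step y x (0, u) (.inQueue i j))),
    integral_exp_neg_mul_expMeasure (add_pos Q.lam_pos Q.mu_pos) hα, valueStep]
  rw [← eventDiscount]
  congr 1
  have h01 : (0 : ℝ) ≤ 1 ∧ (1 : ℝ) ≤ 1 := ⟨zero_le_one, le_rfl⟩
  by_cases hi : i = 1
  · have hfun : (fun u : I × I × I => F (Q.step y x (0, u) (.inQueue i j))) =
        fun u => (if (u.1 : ℝ) < Q.arrivalProb then
          (if (u.2.2 : ℝ) < joinProb x (j + 1) then F (.inQueue i (j + 1)) else F (.inQueue i j))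
          else if (u.2.1 : ℝ) < Q.q then (if (u.2.2 : ℝ) < joinProb y j then 1 else 1)
          else if (u.2.2 : ℝ) < joinProb y j then F (.inQueue j j) else c) := by
      funext u
      simp only [step, hi, if_true, arrivalProb, apply_ite F, ite_self]
      rw [hF, expectedReward_served, expectedReward_reneged]
    rw [hfun]
    refine (integral_ite_prod hp hq (hrx _) (hry _) (hry _) _ _ _ _ _ _).trans ?_
    rw [if_pos hi]
    ring
  · have hfun : (fun u : I × I × I => F (Q.step y x (0, u) (.inQueue i j))) =
        fun u => (if (u.1 : ℝ) < Q.arrivalProb then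
          (if (u.2.2 : ℝ) < joinProb x (j + 1) then F (.inQueue i (j + 1)) else F (.inQueue i j))
          else if (u.2.1 : ℝ) < Q.q then (if (u.2.2 : ℝ) < joinProb x j
            then F (.inQueue (i - 1) (j - 1)) else F (.inQueue (i - 1) (j - 1)))
          else if (u.2.2 : ℝ) < joinProb x j then F (.inQueue (i - 1) j)
            else F (.inQueue (i - 1) (j - 1))) := by
      funext u
      simp only [step, hi, if_false, arrivalProb, apply_ite F, ite_self]
    rw [hfun]
    refine (integral_ite_prod hp hq (hrx _) (hrx _) (hrx _) _ _ _ _ _ _).trans ?_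
    rw [if_neg hi]
    ring

lemma zHat_eq (α v y x : ℝ) (i : ℕ) :
    Q.zHat α v y x i = Q.expectedReward α 1 y x (.inQueue i i) - v := rfl

lemma payoff_eq (α v y x : ℝ) (i : ℕ) :
    Q.payoff α v y x i = joinProb y i * (Q.expectedReward α v y x (.inQueue i i) - v) := rfl

end FeedbackQueue

/-! ### Contraction and comparison for the value recursion. -/

/-- The standing assumptions on the parameters of the value recursion. -/
structure IsValueData (b p q : ℝ) (r : ℕ → ℝ) : Prop where
  b_pos : 0 < b
  b_le_one : b ≤ 1
  p_pos : 0 < p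
  p_lt_one : p < 1
  q_pos : 0 < q
  q_le_one : q ≤ 1
  r_nonneg : ∀ k, 0 ≤ r k
  r_le_one : ∀ k, r k ≤ 1
  r_antitone : Antitone r

/-- Iterating the improvement from the bound max(B, 0) gives κ^n max(B, 0), which tends to 0. -/
lemma nonpos_of_le_mul_bound {S : ℕ → ℕ → Prop} {D : ℕ → ℕ → ℝ} {κ B : ℝ} (h0 : 0 ≤ κ)
    (h1 : κ < 1) (hB : ∀ i j, S i j → D i j ≤ B)
    (h : ∀ M, 0 ≤ M → (∀ i j, S i j → D i j ≤ M) → ∀ i j, S i j → D i j ≤ κ * M) :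
    ∀ i j, S i j → D i j ≤ 0 := by
  have key (n : ℕ) : ∀ i j, S i j → D i j ≤ κ ^ n * max B 0 := by
    induction n with
    | zero => exact fun i j hij => by simpa using Or.inl (hB i j hij)
    | succ n ih =>
      intro i j hij
      have := h _ (by positivity) ih i j hij
      rwa [pow_succ', mul_assoc]
  intro i j hij
  have hlim : Filter.Tendsto (fun n : ℕ => κ ^ n * max B 0) Filter.atTop (nhds (0 * max B 0)) :=
    (tendsto_pow_atTop_nhds_zero_of_lt_one h0 h1).mul_const _
  rw [zero_mul] at hlim
  exact ge_of_tendsto' hlim fun n => key n i j hij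

lemma eq_one_or_exists_eq_add_one {i : ℕ} (hi : 1 ≤ i) : i = 1 ∨ ∃ k, i = k + 1 ∧ 1 ≤ k := by
  rcases hi.eq_or_lt with h' | h'
  · exact Or.inl h'.symm
  · exact Or.inr ⟨i - 1, by omega, by omega⟩

lemma exists_eq_add_one_of_pos {j : ℕ} (hj : 1 ≤ j) : ∃ k, j = k + 1 := ⟨j - 1, by omega⟩

lemma convex_comb_le {a u w M : ℝ} (h0 : 0 ≤ a) (h1 : a ≤ 1) (hu : u ≤ M) (hw : w ≤ M) :
    a * u + (1 - a) * w ≤ M := by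
  nlinarith [mul_le_mul_of_nonneg_left hu h0, mul_le_mul_of_nonneg_left hw (sub_nonneg.2 h1)]

lemma le_convex_comb {a u w M : ℝ} (h0 : 0 ≤ a) (h1 : a ≤ 1) (hu : M ≤ u) (hw : M ≤ w) :
    M ≤ a * u + (1 - a) * w := by
  nlinarith [mul_le_mul_of_nonneg_left hu h0, mul_le_mul_of_nonneg_left hw (sub_nonneg.2 h1)]

lemma valueStep_one (b p q : ℝ) (r e : ℕ → ℝ) (g : ℕ → ℕ → ℝ) (j : ℕ) :
    valueStep b p q r e g 1 j =
      b * (p * (r (j + 1) * g 1 (j + 1) + (1 - r (j + 1)) * g 1 j) +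
        (1 - p) * (q + (1 - q) * e j)) := by
  simp [valueStep]

lemma valueStep_succ (b p q : ℝ) (r e : ℕ → ℝ) (g : ℕ → ℕ → ℝ) {i : ℕ} (hi : 1 ≤ i) (j : ℕ) :
    valueStep b p q r e g (i + 1) j =
      b * (p * (r (j + 1) * g (i + 1) (j + 1) + (1 - r (j + 1)) * g (i + 1) j) +
        (1 - p) * (q * g i (j - 1) + (1 - q) * (r j * g i j + (1 - r j) * g i (j - 1)))) := by
  rw [valueStep, if_neg (by omega), Nat.add_sub_cancel]

namespace IsValueData

variable {b p q : ℝ} {r : ℕ → ℝ}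

/-- A one-sided contraction. At j = N the arrival term stays inside the triangle because r (N + 1) =
0; M must be nonnegative because a success contributes difference 0. -/
lemma valueStep_sub_le (h : IsValueData b p q r) {N : ℕ} (hN : r (N + 1) = 0) {e e' : ℕ → ℝ}
    {f g : ℕ → ℕ → ℝ} {M : ℝ} (hM : ∀ i j, 1 ≤ i ∧ i ≤ j ∧ j ≤ N → f i j - g i j ≤ M) {i j : ℕ}
    (hij : 1 ≤ i ∧ i ≤ j ∧ j ≤ N) (he : e j - e' j ≤ M) (hM0 : 0 ≤ M) :
    valueStep b p q r e f i j - valueStep b p q r e' g i j ≤ b * M := by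
  obtain ⟨hi, hle, hj⟩ := hij
  have hA : r (j + 1) * (f i (j + 1) - g i (j + 1)) + (1 - r (j + 1)) * (f i j - g i j) ≤ M := by
    rcases hj.eq_or_lt with rfl | hlt
    · rw [hN]
      simpa using hM i j ⟨hi, hle, le_rfl⟩
    · exact convex_comb_le (h.r_nonneg _) (h.r_le_one _) (hM _ _ ⟨hi, by omega, hlt⟩)
        (hM _ _ ⟨hi, hle, hj⟩)
  have hp0 := h.p_pos.le
  have hp1 := h.p_lt_one.le
  have hq0 := h.q_pos.le
  have hq1 := h.q_le_one
  obtain rfl | ⟨k, rfl, hk⟩ := eq_one_or_exists_eq_add_one hi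
  · rw [valueStep_one, valueStep_one, ← mul_sub]
    refine mul_le_mul_of_nonneg_left ?_ h.b_pos.le
    have hS : (1 - q) * (e j - e' j) ≤ M :=
      (mul_le_mul_of_nonneg_left he (by linarith)).trans
        (mul_le_of_le_one_left hM0 (by linarith))
    have := convex_comb_le hp0 hp1 hA hS
    linarith
  · rw [valueStep_succ _ _ _ _ _ _ hk, valueStep_succ _ _ _ _ _ _ hk, ← mul_sub]
    refine mul_le_mul_of_nonneg_left ?_ h.b_pos.le
    have h1 := hM k (j - 1) ⟨hk, by omega, by omega⟩
    have hS := convex_comb_le hq0 hq1 h1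
      (convex_comb_le (h.r_nonneg j) (h.r_le_one j) (hM k j ⟨hk, by omega, hj⟩) h1)
    have := convex_comb_le hp0 hp1 hA hS
    linarith

/-- Comparison of an approximate subsolution with a supersolution of the value recursion. -/
lemma sub_le_of_valueStep (h : IsValueData b p q r) (hb : b < 1) {N : ℕ} (hN : r (N + 1) = 0)
    {e e' : ℕ → ℝ} {f g : ℕ → ℕ → ℝ} {ε : ℝ} (hε : 0 ≤ ε)
    (hf : ∀ i j, 1 ≤ i ∧ i ≤ j ∧ j ≤ N → f i j ≤ valueStep b p q r e f i j + ε)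
    (hg : ∀ i j, 1 ≤ i ∧ i ≤ j ∧ j ≤ N → valueStep b p q r e' g i j ≤ g i j)
    (he : ∀ M, 0 ≤ M → ∀ j, 1 ≤ j → j ≤ N → f j j - g j j ≤ M → e j - e' j ≤ M) :
    ∀ i j, 1 ≤ i ∧ i ≤ j ∧ j ≤ N → f i j - g i j ≤ ε / (1 - b) := by
  have h1b : 0 < 1 - b := by linarith
  have hεb : 0 ≤ ε / (1 - b) := by positivity
  obtain ⟨B, hB⟩ : ∃ B, ∀ i j, 1 ≤ i ∧ i ≤ j ∧ j ≤ N → f i j - g i j - ε / (1 - b) ≤ B := by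
    obtain ⟨B, hB⟩ := ((Finset.range (N + 1) ×ˢ Finset.range (N + 1)).image
      fun z => f z.1 z.2 - g z.1 z.2 - ε / (1 - b)).bddAbove
    refine ⟨B, fun i j hij => hB ?_⟩
    simp only [Finset.coe_image, Set.mem_image, Finset.mem_coe, Finset.mem_product,
      Finset.mem_range]
    exact ⟨(i, j), ⟨by omega, by omega⟩, rfl⟩
  -- The shift ε / (1 - b) is the fixed point of M ↦ b M + ε, so after subtracting it the error
  -- disappears.
  have := nonpos_of_le_mul_bound (S := fun i j => 1 ≤ i ∧ i ≤ j ∧ j ≤ N)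
    (D := fun i j => f i j - g i j - ε / (1 - b)) h.b_pos.le hb hB ?_
  · intro i j hij
    linarith [this i j hij]
  · intro M hM hD i j hij
    have hD' : ∀ i j, 1 ≤ i ∧ i ≤ j ∧ j ≤ N → f i j - g i j ≤ M + ε / (1 - b) :=
      fun i j hij => by linarith [hD i j hij]
    have h2 := h.valueStep_sub_le hN hD' hij (e := e) (e' := e')
      (he _ (by positivity) j (by omega) hij.2.2
        (hD' j j ⟨by omega, le_rfl, hij.2.2⟩)) (by positivity)
    have h3 := hf i j hij
    have h4 := hg i j hij
    have h5 : b * (ε / (1 - b)) + ε = ε / (1 - b) := by field_simp; ring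
    linarith

lemma le_of_valueStep (h : IsValueData b p q r) (hb : b < 1) {N : ℕ} (hN : r (N + 1) = 0)
    {e e' : ℕ → ℝ} {f g : ℕ → ℕ → ℝ}
    (hf : ∀ i j, 1 ≤ i ∧ i ≤ j ∧ j ≤ N → f i j ≤ valueStep b p q r e f i j)
    (hg : ∀ i j, 1 ≤ i ∧ i ≤ j ∧ j ≤ N → valueStep b p q r e' g i j ≤ g i j)
    (he : ∀ M, 0 ≤ M → ∀ j, 1 ≤ j → j ≤ N → f j j - g j j ≤ M → e j - e' j ≤ M) :
    ∀ i j, 1 ≤ i ∧ i ≤ j ∧ j ≤ N → f i j ≤ g i j := by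
  intro i j hij
  have := h.sub_le_of_valueStep hb hN le_rfl (fun i j hij => by rw [add_zero]; exact hf i j hij)
    hg he i j hij
  rw [zero_div] at this
  linarith

end IsValueData

/-! ### The value of never reneging and its monotonicity in position and queue length. -/

/-- The value recursion of a tagged customer who always goes back to the queue. -/
noncomputable def rejoinStep (b p q : ℝ) (r : ℕ → ℝ) (g : ℕ → ℕ → ℝ) : ℕ → ℕ → ℝ :=
  valueStep b p q r (fun k => g k k) g

/-- The iterates of `rejoinStep`, starting from zero. -/
noncomputable def rejoinIter (b p q : ℝ) (r : ℕ → ℝ) : ℕ → ℕ → ℕ → ℝ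
  | 0 => fun _ _ => 0
  | n + 1 => rejoinStep b p q r (rejoinIter b p q r n)

/-- The value of a tagged customer who always goes back to the queue. -/
noncomputable def rejoinValue (b p q : ℝ) (r : ℕ → ℝ) (i j : ℕ) : ℝ :=
  ⨆ n, rejoinIter b p q r n i j

/-- Monotonicity properties that `rejoinStep` preserves. -/
structure RejoinInvariant (b p q : ℝ) (r : ℕ → ℝ) (g : ℕ → ℕ → ℝ) : Prop where
  nonneg : ∀ i j, 1 ≤ i → i ≤ j → 0 ≤ g i j
  le_one : ∀ i j, 1 ≤ i → i ≤ j → g i j ≤ 1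
  le_step : ∀ i j, 1 ≤ i → i ≤ j → g i j ≤ rejoinStep b p q r g i j
  anti_length : ∀ i j, 1 ≤ i → i ≤ j → g i (j + 1) ≤ g i j
  anti_diag : ∀ j, 1 ≤ j → g (j + 1) (j + 1) ≤ g j j

namespace IsValueData

variable {b p q : ℝ} {r : ℕ → ℝ}

lemma rejoinStep_mono (h : IsValueData b p q r) {f g : ℕ → ℕ → ℝ}
    (hfg : ∀ i j, 1 ≤ i → i ≤ j → f i j ≤ g i j) (i j : ℕ) (hi : 1 ≤ i) (hij : i ≤ j) :
    rejoinStep b p q r f i j ≤ rejoinStep b p q r g i j := by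
  have hp0 := h.p_pos.le
  have hp1 : 0 ≤ 1 - p := by linarith [h.p_lt_one]
  have hq0 := h.q_pos.le
  have hq1 : 0 ≤ 1 - q := by linarith [h.q_le_one]
  have hr0 := h.r_nonneg
  have hr1 (k : ℕ) : 0 ≤ 1 - r k := by linarith [h.r_le_one k]
  have hb := h.b_pos.le
  have a1 := hfg i (j + 1) hi (by omega)
  have a2 := hfg i j hi hij
  have a3 := hfg j j (by omega) le_rfl
  have := hr0 (j + 1)
  have := hr1 (j + 1)
  have := hr0 j
  have := hr1 j
  unfold rejoinStep
  obtain rfl | ⟨k, rfl, hk⟩ := eq_one_or_exists_eq_add_one hi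
  · rw [valueStep_one, valueStep_one]
    gcongr
  · rw [valueStep_succ _ _ _ _ _ _ hk, valueStep_succ _ _ _ _ _ _ hk]
    have a4 := hfg k (j - 1) hk (by omega)
    have a5 := hfg k j hk (by omega)
    gcongr

lemma rejoinStep_nonneg (h : IsValueData b p q r) {g : ℕ → ℕ → ℝ}
    (hg : ∀ i j, 1 ≤ i → i ≤ j → 0 ≤ g i j) (i j : ℕ) (hi : 1 ≤ i) (hij : i ≤ j) :
    0 ≤ rejoinStep b p q r g i j := by
  have h1 : (0 : ℝ) ≤ rejoinStep b p q r (fun _ _ => 0) i j := by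
    have := h.b_pos
    have := h.q_pos
    have := h.p_lt_one
    have : 0 < 1 - p := by linarith
    simp only [rejoinStep, valueStep, mul_zero, add_zero]
    split_ifs <;> positivity
  exact h1.trans (h.rejoinStep_mono (f := fun _ _ => 0) hg i j hi hij)

lemma rejoinStep_le_one (h : IsValueData b p q r) {g : ℕ → ℕ → ℝ}
    (hg : ∀ i j, 1 ≤ i → i ≤ j → g i j ≤ 1) (i j : ℕ) (hi : 1 ≤ i) (hij : i ≤ j) :
    rejoinStep b p q r g i j ≤ 1 := by
  refine (h.rejoinStep_mono (g := fun _ _ => 1) hg i j hi hij).trans ?_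
  have : rejoinStep b p q r (fun _ _ => 1) i j = b := by
    simp only [rejoinStep, valueStep]
    split_ifs <;> ring
  rw [this]
  exact h.b_le_one

/-- The value at length j + 1 separates the two mixtures over the next arrival, and likewise for a
rejoining customer. The surplus term is kept because it later yields strict decrease in
`rejoinValue_length_strictAnti`. -/
lemma rejoinStep_anti_length (h : IsValueData b p q r) {g : ℕ → ℕ → ℝ}
    (hg : RejoinInvariant b p q r g) (i j : ℕ) (hi : 1 ≤ i) (hij : i ≤ j) :
    rejoinStep b p q r g i (j + 1) + b * ((1 - p) * (if i = 1 then
      (1 - q) * (g j j - g (j + 1) (j + 1)) else q * (g (i - 1) (j - 1) - g (i - 1) j))) ≤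
    rejoinStep b p q r g i j := by
  have hq1 : 0 ≤ 1 - q := by linarith [h.q_le_one]
  have hA : r (j + 1 + 1) * g i (j + 1 + 1) + (1 - r (j + 1 + 1)) * g i (j + 1) ≤
      r (j + 1) * g i (j + 1) + (1 - r (j + 1)) * g i j :=
    (convex_comb_le (h.r_nonneg _) (h.r_le_one _) (hg.anti_length i (j + 1) hi (by omega))
      le_rfl).trans (le_convex_comb (h.r_nonneg _) (h.r_le_one _) le_rfl
        (hg.anti_length i j hi hij))
  have hb := h.b_pos.le
  have hp0 := h.p_pos.le
  have hp1 : 0 ≤ 1 - p := by linarith [h.p_lt_one]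
  have hA' := mul_le_mul_of_nonneg_left hA hp0
  unfold rejoinStep
  obtain rfl | ⟨k, rfl, hk⟩ := eq_one_or_exists_eq_add_one hi
  · rw [valueStep_one, valueStep_one, ← mul_add, if_pos rfl]
    refine mul_le_mul_of_nonneg_left ?_ hb
    linarith
  · obtain ⟨l, rfl⟩ := exists_eq_add_one_of_pos (hi.trans hij)
    rw [valueStep_succ _ _ _ _ _ _ hk, valueStep_succ _ _ _ _ _ _ hk, ← mul_add,
      if_neg (by omega)]
    simp only [Nat.add_sub_cancel]
    refine mul_le_mul_of_nonneg_left ?_ hb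
    have hB : r (l + 1 + 1) * g k (l + 1 + 1) + (1 - r (l + 1 + 1)) * g k (l + 1) ≤
        r (l + 1) * g k (l + 1) + (1 - r (l + 1)) * g k l :=
      (convex_comb_le (h.r_nonneg _) (h.r_le_one _) (hg.anti_length k (l + 1) hk (by omega))
        le_rfl).trans (le_convex_comb (h.r_nonneg _) (h.r_le_one _) le_rfl
          (hg.anti_length k l hk (by omega)))
    have hB' := mul_le_mul_of_nonneg_left (mul_le_mul_of_nonneg_left hB hq1) hp1
    linarith

/-- The value in the last of `j + 1` positions is at most the discounted value after one service
completion. -/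
lemma rejoinStep_diag_le (h : IsValueData b p q r) {g : ℕ → ℕ → ℝ}
    (ha : ∀ i j, 1 ≤ i → i ≤ j → g i (j + 1) ≤ g i j) (j : ℕ) (hj : 1 ≤ j) :
    rejoinStep b p q r g (j + 1) (j + 1) ≤ b * (p * g (j + 1) (j + 1) + (1 - p) * g j j) := by
  have hp1 : 0 ≤ 1 - p := by linarith [h.p_lt_one]
  unfold rejoinStep
  rw [valueStep_succ _ _ _ _ _ _ hj]
  simp only [Nat.add_sub_cancel]
  refine mul_le_mul_of_nonneg_left (add_le_add
    (mul_le_mul_of_nonneg_left ?_ h.p_pos.le) (mul_le_mul_of_nonneg_left ?_ hp1)) h.b_pos.le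
  · exact convex_comb_le (h.r_nonneg _) (h.r_le_one _) (ha _ _ (by omega) le_rfl) le_rfl
  · exact convex_comb_le h.q_pos.le h.q_le_one le_rfl
      (convex_comb_le (h.r_nonneg _) (h.r_le_one _) (ha _ _ hj le_rfl) le_rfl)

/-- The five properties must be propagated together. The diagonal decrease needs `le_step`: the new
value at (j + 1, j + 1) is bounded by the old one at (j, j), which is at most the new one there. -/
lemma rejoinInvariant_step (h : IsValueData b p q r) {g : ℕ → ℕ → ℝ}
    (hg : RejoinInvariant b p q r g) : RejoinInvariant b p q r (rejoinStep b p q r g) where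
  nonneg := h.rejoinStep_nonneg hg.nonneg
  le_one := h.rejoinStep_le_one hg.le_one
  le_step := h.rejoinStep_mono hg.le_step
  anti_length i j hi hij := by
    refine le_trans ?_ (h.rejoinStep_anti_length hg i j hi hij)
    rw [le_add_iff_nonneg_right]
    refine mul_nonneg h.b_pos.le (mul_nonneg (by linarith [h.p_lt_one]) ?_)
    split_ifs with h1
    · exact mul_nonneg (by linarith [h.q_le_one])
        (sub_nonneg.2 (hg.anti_diag j (by omega)))
    · refine mul_nonneg h.q_pos.le (sub_nonneg.2 ?_)
      obtain ⟨k, rfl⟩ := exists_eq_add_one_of_pos (hi.trans hij)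
      exact hg.anti_length _ _ (by omega) (by omega)
  anti_diag j hj := by
    refine (h.rejoinStep_diag_le hg.anti_length j hj).trans ?_
    have h1 := hg.nonneg j j hj le_rfl
    have h2 := convex_comb_le h.p_pos.le h.p_lt_one.le (hg.anti_diag j hj) le_rfl
    calc b * (p * g (j + 1) (j + 1) + (1 - p) * g j j) ≤ b * g j j :=
          mul_le_mul_of_nonneg_left h2 h.b_pos.le
      _ ≤ g j j := mul_le_of_le_one_left h1 h.b_le_one
      _ ≤ _ := hg.le_step j j hj le_rfl

lemma rejoinInvariant_iter (h : IsValueData b p q r) (n : ℕ) :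
    RejoinInvariant b p q r (rejoinIter b p q r n) := by
  induction n with
  | zero => exact {
      nonneg := fun _ _ _ _ => le_rfl
      le_one := fun _ _ _ _ => zero_le_one
      le_step := h.rejoinStep_nonneg fun _ _ _ _ => le_rfl
      anti_length := fun _ _ _ _ => le_rfl
      anti_diag := fun _ _ => le_rfl }
  | succ n ih => exact h.rejoinInvariant_step ih

/-- The iterates increase and are bounded by 1; the limit thus exists even for b = 1, and it
inherits the recursion and the monotonicity. -/
lemma tendsto_rejoinIter (h : IsValueData b p q r) {i j : ℕ} (hi : 1 ≤ i) (hij : i ≤ j) :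
    Filter.Tendsto (fun n => rejoinIter b p q r n i j) Filter.atTop
      (nhds (rejoinValue b p q r i j)) := by
  refine tendsto_atTop_ciSup (monotone_nat_of_le_succ fun n => ?_) ⟨1, ?_⟩
  · exact (h.rejoinInvariant_iter n).le_step i j hi hij
  · rintro _ ⟨n, rfl⟩
    exact (h.rejoinInvariant_iter n).le_one i j hi hij

lemma rejoinValue_eq (h : IsValueData b p q r) {i j : ℕ} (hi : 1 ≤ i) (hij : i ≤ j) :
    rejoinValue b p q r i j = rejoinStep b p q r (rejoinValue b p q r) i j := by
  refine tendsto_nhds_unique ((h.tendsto_rejoinIter hi hij).comp (Filter.tendsto_add_atTop_nat 1))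
    ?_
  have t1 := h.tendsto_rejoinIter hi (show i ≤ j + 1 by omega)
  have t2 := h.tendsto_rejoinIter hi hij
  have t3 := h.tendsto_rejoinIter (hi.trans hij) le_rfl
  simp only [Function.comp_def, rejoinIter, rejoinStep]
  obtain rfl | ⟨k, rfl, hk⟩ := eq_one_or_exists_eq_add_one hi
  · simp only [valueStep_one]
    exact ((((t1.const_mul _).add (t2.const_mul _)).const_mul _).add
      (((t3.const_mul _).const_add _).const_mul _)).const_mul _
  · simp only [valueStep_succ _ _ _ _ _ _ hk]
    have t4 := h.tendsto_rejoinIter hk (show k ≤ j - 1 by omega)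
    have t5 := h.tendsto_rejoinIter hk (show k ≤ j by omega)
    exact ((((t1.const_mul _).add (t2.const_mul _)).const_mul _).add
      (((t4.const_mul _).add (((t5.const_mul _).add (t4.const_mul _)).const_mul _)).const_mul
        _)).const_mul _

lemma rejoinInvariant_value (h : IsValueData b p q r) :
    RejoinInvariant b p q r (rejoinValue b p q r) where
  nonneg i j hi hij := ge_of_tendsto' (h.tendsto_rejoinIter hi hij)
    fun n => (h.rejoinInvariant_iter n).nonneg i j hi hij
  le_one i j hi hij := le_of_tendsto' (h.tendsto_rejoinIter hi hij)
    fun n => (h.rejoinInvariant_iter n).le_one i j hi hij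
  le_step i j hi hij := (h.rejoinValue_eq hi hij).le
  anti_length i j hi hij := le_of_tendsto_of_tendsto'
    (h.tendsto_rejoinIter hi (by omega)) (h.tendsto_rejoinIter hi hij)
    fun n => (h.rejoinInvariant_iter n).anti_length i j hi hij
  anti_diag j hj := le_of_tendsto_of_tendsto'
    (h.tendsto_rejoinIter (by omega) le_rfl) (h.tendsto_rejoinIter hj le_rfl)
    fun n => (h.rejoinInvariant_iter n).anti_diag j hj

lemma rejoinValue_pos (h : IsValueData b p q r) {i j : ℕ} (hi : 1 ≤ i) (hij : i ≤ j) :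
    0 < rejoinValue b p q r i j := by
  have hb := h.b_pos
  have hp := h.p_pos
  have hp1 : 0 < 1 - p := by linarith [h.p_lt_one]
  have hq := h.q_pos
  have hq1 : 0 ≤ 1 - q := by linarith [h.q_le_one]
  have hnn := h.rejoinInvariant_value.nonneg
  induction i, hi using Nat.le_induction generalizing j with
  | base =>
    rw [h.rejoinValue_eq le_rfl hij, rejoinStep, valueStep_one]
    have h1 := le_convex_comb (h.r_nonneg (j + 1)) (h.r_le_one (j + 1))
      (hnn 1 (j + 1) le_rfl (by omega)) (hnn 1 j le_rfl hij)
    have h2 := hnn j j hij le_rfl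
    positivity
  | succ k hk ih =>
    rw [h.rejoinValue_eq (by omega) hij, rejoinStep, valueStep_succ _ _ _ _ _ _ hk]
    have h1 := le_convex_comb (h.r_nonneg (j + 1)) (h.r_le_one (j + 1))
      (hnn (k + 1) (j + 1) (by omega) (by omega)) (hnn (k + 1) j (by omega) hij)
    have h2 := le_convex_comb (h.r_nonneg j) (h.r_le_one j)
      (hnn k j hk (by omega)) (hnn k (j - 1) hk (by omega))
    have h3 := ih (show k ≤ j - 1 by omega)
    positivity

lemma rejoinValue_diag_succ_le (h : IsValueData b p q r) {j : ℕ} (hj : 1 ≤ j) :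
    (1 - b * p) * rejoinValue b p q r (j + 1) (j + 1) ≤
      b * (1 - p) * rejoinValue b p q r j j := by
  have h1 := h.rejoinStep_diag_le h.rejoinInvariant_value.anti_length j hj
  rw [← h.rejoinValue_eq (by omega) le_rfl] at h1
  linarith

lemma one_sub_pos (h : IsValueData b p q r) : 0 < 1 - b * p := by
  have := mul_le_of_le_one_left h.p_pos.le h.b_le_one
  linarith [h.p_lt_one]

/-- Waiting for one more service completion costs the factor b (1 - p) / (1 - b p), which is below 1
exactly when b < 1. -/
lemma rejoinValue_diag_succ_lt (h : IsValueData b p q r) (hb : b < 1) {j : ℕ} (hj : 1 ≤ j) :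
    rejoinValue b p q r (j + 1) (j + 1) < rejoinValue b p q r j j := by
  have h1 := h.rejoinValue_diag_succ_le hj
  have h2 := mul_lt_mul_of_pos_right (show b * (1 - p) < 1 - b * p by linarith)
    (h.rejoinValue_pos hj le_rfl)
  exact lt_of_mul_lt_mul_left (h1.trans_lt h2) h.one_sub_pos.le

lemma rejoinValue_diag_antitone (h : IsValueData b p q r) {j k : ℕ} (hj : 1 ≤ j) (hjk : j ≤ k) :
    rejoinValue b p q r k k ≤ rejoinValue b p q r j j := by
  induction k, hjk using Nat.le_induction with
  | base => exact le_rfl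
  | succ k hk ih => exact (h.rejoinInvariant_value.anti_diag k (by omega)).trans ih

lemma rejoinValue_diag_strictAnti (h : IsValueData b p q r) (hb : b < 1) {j k : ℕ} (hj : 1 ≤ j)
    (hjk : j < k) : rejoinValue b p q r k k < rejoinValue b p q r j j :=
  (h.rejoinValue_diag_antitone (by omega) hjk).trans_lt (h.rejoinValue_diag_succ_lt hb hj)

lemma rejoinValue_diag_le_pow (h : IsValueData b p q r) (j : ℕ) :
    rejoinValue b p q r (j + 1) (j + 1) ≤ (b * (1 - p) / (1 - b * p)) ^ j := by
  have h0 : 0 ≤ b * (1 - p) / (1 - b * p) :=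
    div_nonneg (mul_nonneg h.b_pos.le (by linarith [h.p_lt_one])) h.one_sub_pos.le
  induction j with
  | zero => simpa using h.rejoinInvariant_value.le_one 1 1 le_rfl le_rfl
  | succ j ih =>
    have h1 := h.rejoinValue_diag_succ_le (show 1 ≤ j + 1 by omega)
    rw [mul_comm, ← le_div_iff₀ h.one_sub_pos] at h1
    refine h1.trans ?_
    rw [mul_div_right_comm, pow_succ']
    exact mul_le_mul_of_nonneg_left ih h0

/-- Customers behind matter only because a failed service sends the tagged customer to the end. This
is the base i = 1, through the strict diagonal decrease; a success at the head carries the loss to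
higher i. -/
lemma rejoinValue_length_strictAnti (h : IsValueData b p q r) (hb : b < 1) (hq : q < 1) {i j : ℕ}
    (hi : 1 ≤ i) (hij : i ≤ j) : rejoinValue b p q r i (j + 1) < rejoinValue b p q r i j := by
  have hp1 : 0 < 1 - p := by linarith [h.p_lt_one]
  have hq1 : 0 < 1 - q := by linarith
  have hbp := h.b_pos
  induction i, hi using Nat.le_induction generalizing j with
  | base =>
    have h1 := h.rejoinStep_anti_length h.rejoinInvariant_value 1 j le_rfl hij
    rw [← h.rejoinValue_eq le_rfl hij, ← h.rejoinValue_eq le_rfl (by omega), if_pos rfl] at h1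
    have h2 := sub_pos.2 (h.rejoinValue_diag_succ_lt hb hij)
    have : 0 < b * ((1 - p) * ((1 - q) *
      (rejoinValue b p q r j j - rejoinValue b p q r (j + 1) (j + 1)))) := by positivity
    linarith
  | succ k hk ih =>
    obtain ⟨l, rfl⟩ := exists_eq_add_one_of_pos (show 1 ≤ j by omega)
    have h1 := h.rejoinStep_anti_length h.rejoinInvariant_value (k + 1) (l + 1) (by omega) hij
    rw [← h.rejoinValue_eq (by omega) hij, ← h.rejoinValue_eq (by omega) (by omega),
      if_neg (by omega)] at h1
    simp only [Nat.add_sub_cancel] at h1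
    have h2 := sub_pos.2 (ih (show k ≤ l by omega))
    have hq0 := h.q_pos
    have : 0 < b * ((1 - p) * (q *
      (rejoinValue b p q r k l - rejoinValue b p q r k (l + 1)))) := by positivity
    linarith

end IsValueData

/-! ### Dependence of the value on the behaviour of the others. -/

namespace IsValueData

variable {b p q : ℝ} {r r' : ℕ → ℝ}

lemma valueStep_sub_valueStep (b p q : ℝ) (r r' e : ℕ → ℝ) (g : ℕ → ℕ → ℝ) (i j : ℕ) :
    valueStep b p q r e g i j - valueStep b p q r' e g i j =
      b * (p * ((r' (j + 1) - r (j + 1)) * (g i j - g i (j + 1))) +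
        (1 - p) * (if i = 1 then 0
          else (1 - q) * ((r' j - r j) * (g (i - 1) (j - 1) - g (i - 1) j)))) := by
  unfold valueStep
  split_ifs <;> ring

/-- Raising the acceptance probabilities lowers the value by at least the following. -/
lemma rejoinStep_gap (h : IsValueData b p q r) (hle : ∀ k, r k ≤ r' k)
    {g : ℕ → ℕ → ℝ} (ha : ∀ i j, 1 ≤ i → i ≤ j → g i (j + 1) ≤ g i j) (i j : ℕ) (hi : 1 ≤ i)
    (hij : i ≤ j) : rejoinStep b p q r' g i j + b * ((1 - p) * (if i = 1 then 0
      else (1 - q) * ((r' j - r j) * (g (i - 1) (j - 1) - g (i - 1) j)))) ≤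
      rejoinStep b p q r g i j := by
  have h1 := valueStep_sub_valueStep b p q r r' (fun k => g k k) g i j
  have h2 : 0 ≤ b * (p * ((r' (j + 1) - r (j + 1)) * (g i j - g i (j + 1)))) :=
    mul_nonneg h.b_pos.le (mul_nonneg h.p_pos.le (mul_nonneg (sub_nonneg.2 (hle _))
      (sub_nonneg.2 (ha i j hi hij))))
  unfold rejoinStep
  linarith

lemma rejoinStep_le_of_le (h : IsValueData b p q r) (hle : ∀ k, r k ≤ r' k)
    {g : ℕ → ℕ → ℝ} (ha : ∀ i j, 1 ≤ i → i ≤ j → g i (j + 1) ≤ g i j) (i j : ℕ) (hi : 1 ≤ i)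
    (hij : i ≤ j) : rejoinStep b p q r' g i j ≤ rejoinStep b p q r g i j := by
  refine le_trans ?_ (h.rejoinStep_gap hle ha i j hi hij)
  rw [le_add_iff_nonneg_right]
  refine mul_nonneg h.b_pos.le (mul_nonneg (by linarith [h.p_lt_one]) ?_)
  split_ifs with h1
  · exact le_rfl
  · obtain ⟨k, rfl⟩ := exists_eq_add_one_of_pos (hi.trans hij)
    exact mul_nonneg (by linarith [h.q_le_one]) (mul_nonneg (sub_nonneg.2 (hle _))
      (sub_nonneg.2 (ha _ _ (by omega) (by omega))))

/-- Since longer queues are worse, the value for r is a supersolution of the recursion for the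
larger r'. -/
lemma rejoinValue_anti (h : IsValueData b p q r) (h' : IsValueData b p q r') (hb : b < 1)
    (hle : ∀ k, r k ≤ r' k) {N : ℕ} (hN : r' (N + 1) = 0) (i j : ℕ)
    (hij : 1 ≤ i ∧ i ≤ j ∧ j ≤ N) : rejoinValue b p q r' i j ≤ rejoinValue b p q r i j := by
  refine h'.le_of_valueStep hb hN (e := fun k => rejoinValue b p q r' k k)
    (e' := fun k => rejoinValue b p q r k k) (fun i j hij => ?_) (fun i j hij => ?_)
    (fun M _ j _ _ hM => hM) i j hij
  · exact (h'.rejoinValue_eq hij.1 hij.2.1).le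
  · have := h.rejoinStep_le_of_le hle h.rejoinInvariant_value.anti_length i j hij.1 hij.2.1
    rwa [← h.rejoinValue_eq hij.1 hij.2.1] at this

/-- With n ≥ 1 there is a customer ahead whose failed service may lead her back to position n + 1.
Under r' she accepts it more often, leaving the tagged customer at (n, n + 1) rather than (n, n), a
strict loss. -/
lemma rejoinValue_lt (h : IsValueData b p q r) (h' : IsValueData b p q r') (hb : b < 1)
    (hq : q < 1) (hle : ∀ k, r k ≤ r' k) {N : ℕ} (hN : r' (N + 1) = 0) {n : ℕ} (hn : 1 ≤ n)
    (hnN : n + 1 ≤ N) (hlt : r (n + 1) < r' (n + 1)) :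
    rejoinValue b p q r' (n + 1) (n + 1) < rejoinValue b p q r (n + 1) (n + 1) := by
  have hanti := h.rejoinValue_anti h' hb hle hN
  have h1 := h.rejoinStep_gap hle h.rejoinInvariant_value.anti_length (n + 1) (n + 1) (by omega)
    le_rfl
  rw [if_neg (by omega), ← h.rejoinValue_eq (by omega) le_rfl, Nat.add_sub_cancel] at h1
  have h2 := h.rejoinValue_length_strictAnti hb hq hn le_rfl
  have hM : ∀ i j, 1 ≤ i ∧ i ≤ j ∧ j ≤ N →
      rejoinValue b p q r' i j - rejoinValue b p q r i j ≤ 0 :=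
    fun i j hij => sub_nonpos.2 (hanti i j hij)
  have h3 := h'.valueStep_sub_le hN hM (i := n + 1) (j := n + 1) ⟨by omega, le_rfl, hnN⟩
    (e := fun k => rejoinValue b p q r' k k) (e' := fun k => rejoinValue b p q r k k)
    (hM _ _ ⟨by omega, le_rfl, hnN⟩) le_rfl
  have h4 : rejoinValue b p q r' (n + 1) (n + 1) = valueStep b p q r'
      (fun k => rejoinValue b p q r' k k) (rejoinValue b p q r') (n + 1) (n + 1) :=
    h'.rejoinValue_eq (by omega) le_rfl
  rw [← h4, mul_zero] at h3
  have h5 : 0 < b * ((1 - p) * ((1 - q) * ((r' (n + 1) - r (n + 1)) *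
      (rejoinValue b p q r n n - rejoinValue b p q r n (n + 1))))) := by
    have := h.b_pos
    have : 0 < 1 - p := by linarith [h.p_lt_one]
    have : 0 < 1 - q := by linarith
    have := sub_pos.2 hlt
    have := sub_pos.2 h2
    positivity
  unfold rejoinStep at h1
  linarith

/-- Values lie in [0, 1], so replacing r by r' perturbs one step by at most η, and discounting sums
these errors to η / (1 - b). -/
lemma rejoinValue_sub_le (h : IsValueData b p q r) (h' : IsValueData b p q r') (hb : b < 1)
    {η : ℝ} (hη : 0 ≤ η) (hle : ∀ k, |r k - r' k| ≤ η) {N : ℕ} (hN : r' (N + 1) = 0) (i j : ℕ)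
    (hij : 1 ≤ i ∧ i ≤ j ∧ j ≤ N) :
    rejoinValue b p q r i j - rejoinValue b p q r' i j ≤ η / (1 - b) := by
  have hI := h.rejoinInvariant_value
  have hgap (k i j : ℕ) (hi : 1 ≤ i) (hij : i ≤ j) :
      (r' k - r k) * (rejoinValue b p q r i j - rejoinValue b p q r i (j + 1)) ≤ η := by
    have h1 := hI.nonneg i (j + 1) hi (by omega)
    have h2 := hI.le_one i j hi hij
    have h3 := hI.anti_length i j hi hij
    have h4 := (le_abs_self _).trans ((abs_sub_comm _ _).trans_le (hle k))
    calc _ ≤ η * (rejoinValue b p q r i j - rejoinValue b p q r i (j + 1)) :=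
          mul_le_mul_of_nonneg_right h4 (by linarith)
      _ ≤ η := mul_le_of_le_one_right hη (by linarith)
  refine h'.sub_le_of_valueStep hb hN (e := fun k => rejoinValue b p q r k k)
    (e' := fun k => rejoinValue b p q r' k k) hη (fun i j hij => ?_) (fun i j hij => ?_)
    (fun M _ j _ _ hM => hM) i j hij
  · have h1 := valueStep_sub_valueStep b p q r r' (fun k => rejoinValue b p q r k k)
      (rejoinValue b p q r) i j
    have h2 : rejoinValue b p q r i j = valueStep b p q r (fun k => rejoinValue b p q r k k)
      (rejoinValue b p q r) i j := h.rejoinValue_eq hij.1 hij.2.1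
    rw [← h2] at h1
    have h3 := hgap (j + 1) i j hij.1 hij.2.1
    have h4 : (if i = 1 then 0 else (1 - q) * ((r' j - r j) * (rejoinValue b p q r (i - 1) (j - 1)
        - rejoinValue b p q r (i - 1) j))) ≤ η := by
      split_ifs with hi
      · exact hη
      · obtain ⟨k, rfl⟩ := exists_eq_add_one_of_pos (hij.1.trans hij.2.1)
        have h5 := hgap (k + 1) (i - 1) k (by omega) (by omega)
        rw [Nat.add_sub_cancel]
        exact (mul_le_mul_of_nonneg_left h5 (by linarith [h.q_le_one])).trans
          (mul_le_of_le_one_left hη (by linarith [h.q_pos]))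
    have h5 := convex_comb_le h.p_pos.le h.p_lt_one.le h3 h4
    have h6 := mul_le_mul_of_nonneg_left h5 h.b_pos.le
    have h7 := mul_le_of_le_one_left hη h.b_le_one
    linarith
  · exact (h'.rejoinValue_eq hij.1 hij.2.1).ge

/-- If services never fail, the other customers do not matter. -/
lemma rejoinValue_eq_of_forall_success (h : IsValueData b p 1 r) (h' : IsValueData b p 1 r')
    (hb : b < 1) {N : ℕ} (hN : r (N + 1) = 0) (hN' : r' (N + 1) = 0) (i j : ℕ)
    (hij : 1 ≤ i ∧ i ≤ j ∧ j ≤ N) :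
    rejoinValue b p 1 r i j = rejoinValue b p 1 r' i j := by
  -- The mean discount over one service: the solution of d = b (p d + (1 - p)). The value in
  -- position i is d ^ i.
  set d := b * (1 - p) / (1 - b * p) with hd
  have hd1 : d * (1 - b * p) = b * (1 - p) := div_mul_cancel₀ _ h.one_sub_pos.ne'
  have hstep (s e : ℕ → ℝ) (i j : ℕ) (hi : 1 ≤ i) :
      valueStep b p 1 s e (fun i _ => d ^ i) i j = d ^ i := by
    obtain rfl | ⟨k, rfl, hk⟩ := eq_one_or_exists_eq_add_one hi
    · rw [valueStep_one]
      linear_combination -hd1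
    · rw [valueStep_succ _ _ _ _ _ _ hk, pow_succ]
      linear_combination -(d ^ k) * hd1
  have key {s : ℕ → ℝ} (hs : IsValueData b p 1 s) (hsN : s (N + 1) = 0) :
      rejoinValue b p 1 s i j = d ^ i := by
    refine le_antisymm ?_ ?_
    · exact hs.le_of_valueStep hb hsN (e := fun k => rejoinValue b p 1 s k k)
        (e' := fun k => d ^ k) (g := fun i _ => d ^ i)
        (fun i j hij => (hs.rejoinValue_eq hij.1 hij.2.1).le)
        (fun i j hij => (hstep _ _ i j hij.1).le) (fun M _ j _ _ hM => hM) i j hij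
    · exact hs.le_of_valueStep hb hsN (e' := fun k => rejoinValue b p 1 s k k)
        (e := fun k => d ^ k) (f := fun i _ => d ^ i)
        (fun i j hij => (hstep _ _ i j hij.1).ge)
        (fun i j hij => (hs.rejoinValue_eq hij.1 hij.2.1).ge) (fun M _ j _ _ hM => hM) i j hij
  rw [key h hN, key h' hN']

end IsValueData

/-! ### Threshold strategies as a clipped linear function. -/

lemma joinProb_eq {x : ℝ} (hx : 0 ≤ x) (i : ℕ) : joinProb x i = max 0 (min 1 (x - i + 1)) := by
  have h1 := Nat.floor_le hx
  have h2 := Nat.lt_floor_add_one x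
  unfold joinProb
  split_ifs with h h'
  · have : (i : ℝ) ≤ ⌊x⌋₊ := by exact_mod_cast h
    rw [min_eq_left (by linarith), max_eq_right zero_le_one]
  · rw [h']
    push_cast
    rw [min_eq_right (by linarith), max_eq_right (by linarith)]
    ring
  · have : (⌊x⌋₊ : ℝ) + 2 ≤ i := by exact_mod_cast (show ⌊x⌋₊ + 2 ≤ i by omega)
    rw [min_eq_right (by linarith), max_eq_left (by linarith)]

lemma joinProb_antitone {x : ℝ} (hx : 0 ≤ x) : Antitone (joinProb x) := by
  intro i j hij
  have : (i : ℝ) ≤ j := by exact_mod_cast hij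
  rw [joinProb_eq hx, joinProb_eq hx]
  gcongr

lemma joinProb_mono {x x' : ℝ} (hx : 0 ≤ x) (hxx' : x ≤ x') (i : ℕ) :
    joinProb x i ≤ joinProb x' i := by
  rw [joinProb_eq hx, joinProb_eq (hx.trans hxx')]
  gcongr

lemma abs_joinProb_sub_le {x x' : ℝ} (hx : 0 ≤ x) (hx' : 0 ≤ x') (i : ℕ) :
    |joinProb x i - joinProb x' i| ≤ |x - x'| := by
  rw [joinProb_eq hx, joinProb_eq hx', max_comm 0, max_comm 0]
  refine (abs_max_sub_max_le_abs _ _ _).trans ?_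
  rw [min_comm 1, min_comm 1]
  refine (abs_min_sub_min_le_max _ _ _ _).trans ?_
  simp

lemma joinProb_eq_one {x : ℝ} {i : ℕ} (hx : 0 ≤ x) (hi : (i : ℝ) ≤ x) : joinProb x i = 1 := by
  rw [joinProb_eq hx, min_eq_left (by linarith), max_eq_right zero_le_one]

lemma joinProb_eq_zero {x : ℝ} {i : ℕ} (hx : 0 ≤ x) (hi : x + 1 ≤ i) : joinProb x i = 0 := by
  rw [joinProb_eq hx, max_eq_left]
  exact (min_le_right _ _).trans (by linarith)

lemma joinProb_pos {x : ℝ} {i : ℕ} (hx : 0 ≤ x) (hi : (i : ℝ) < x + 1) : 0 < joinProb x i := by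
  rw [joinProb_eq hx]
  exact lt_max_of_lt_right (lt_min one_pos (by linarith))

lemma joinProb_lt_one {x : ℝ} {i : ℕ} (hx : 0 ≤ x) (hi : x < i) : joinProb x i < 1 := by
  rw [joinProb_eq hx]
  exact max_lt one_pos ((min_le_right _ _).trans_lt (by linarith))

/-! ### Best replies and equilibrium conditions in terms of `rejoinReward`. -/

namespace FeedbackQueue

variable (Q : FeedbackQueue) {α v x y : ℝ}

lemma isValueData (hα : 0 ≤ α) (hx : 0 ≤ x) :
    IsValueData (Q.eventDiscount α) Q.arrivalProb Q.q (joinProb x) where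
  b_pos := div_pos (add_pos Q.lam_pos Q.mu_pos) (by linarith [Q.lam_pos, Q.mu_pos])
  b_le_one := by
    rw [eventDiscount, div_le_one (by linarith [Q.lam_pos, Q.mu_pos])]
    linarith
  p_pos := Q.arrivalProb_pos
  p_lt_one := Q.arrivalProb_lt_one
  q_pos := Q.q_pos
  q_le_one := Q.q_le_one
  r_nonneg := joinProb_nonneg hx
  r_le_one := joinProb_le_one x
  r_antitone := joinProb_antitone hx

lemma eventDiscount_lt_one (hα : 0 < α) : Q.eventDiscount α < 1 := by
  rw [eventDiscount, div_lt_one (by linarith [Q.lam_pos, Q.mu_pos])]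
  linarith

/-- The expected discounted reward of a tagged customer who always rejoins, all others using
threshold `x`. -/
noncomputable def rejoinReward (α x : ℝ) : ℕ → ℕ → ℝ :=
  rejoinValue (Q.eventDiscount α) Q.arrivalProb Q.q (joinProb x)

/-- Each alternative says that giving up for v at position j brings no gain: it never happens, or v
is at most the value of going back under y, or under perpetual rejoining. The second alternative
lets a necessary condition for equilibrium be fed in directly. -/
lemma expectedReward_le_rejoinReward (hα : 0 < α) (hv : 0 ≤ v) (hy : 0 ≤ y) (hx : 0 ≤ x) {N : ℕ}
    (hN : joinProb x (N + 1) = 0)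
    (h : ∀ j, 1 ≤ j → j ≤ N → joinProb y j = 1 ∨ v ≤ Q.expectedReward α v y x (.inQueue j j) ∨
      v ≤ Q.rejoinReward α x j j) {i j : ℕ} (hij : 1 ≤ i ∧ i ≤ j ∧ j ≤ N) :
    Q.expectedReward α v y x (.inQueue i j) ≤ Q.rejoinReward α x i j := by
  have hd := Q.isValueData hα.le hx
  refine hd.le_of_valueStep (Q.eventDiscount_lt_one hα) hN
    (f := fun i j => Q.expectedReward α v y x (.inQueue i j))
    (e := fun k => joinProb y k * Q.expectedReward α v y x (.inQueue k k) +
      (1 - joinProb y k) * v)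
    (e' := fun k => Q.rejoinReward α x k k) (g := Q.rejoinReward α x)
    (fun i j _ => (Q.expectedReward_inQueue hα.le hv hy hx i j).le)
    (fun i j hij => (hd.rejoinValue_eq hij.1 hij.2.1).ge) (fun M hM j hj hjN hD => ?_) i j hij
  have h0 := joinProb_nonneg hy j
  have h1 := joinProb_le_one y j
  rcases h j hj hjN with h2 | h2 | h2
  · rw [h2]
    linarith
  · have := convex_comb_le h0 h1 le_rfl h2
    linarith
  · have := convex_comb_le h0 h1 hD (show v - Q.rejoinReward α x j j ≤ M by linarith)
    linarith

lemma rejoinReward_le_expectedReward (hα : 0 < α) (hv : 0 ≤ v) (hy : 0 ≤ y) (hx : 0 ≤ x) {N : ℕ}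
    (hN : joinProb x (N + 1) = 0)
    (h : ∀ j, 1 ≤ j → j ≤ N → joinProb y j = 1 ∨ Q.rejoinReward α x j j ≤ v) {i j : ℕ}
    (hij : 1 ≤ i ∧ i ≤ j ∧ j ≤ N) :
    Q.rejoinReward α x i j ≤ Q.expectedReward α v y x (.inQueue i j) := by
  have hd := Q.isValueData hα.le hx
  refine hd.le_of_valueStep (Q.eventDiscount_lt_one hα) hN
    (g := fun i j => Q.expectedReward α v y x (.inQueue i j))
    (e' := fun k => joinProb y k * Q.expectedReward α v y x (.inQueue k k) +
      (1 - joinProb y k) * v)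
    (e := fun k => Q.rejoinReward α x k k) (f := Q.rejoinReward α x)
    (fun i j hij => (hd.rejoinValue_eq hij.1 hij.2.1).le)
    (fun i j _ => (Q.expectedReward_inQueue hα.le hv hy hx i j).ge)
    (fun M hM j hj hjN hD => ?_) i j hij
  have h0 := joinProb_nonneg hy j
  have h1 := joinProb_le_one y j
  rcases h j hj hjN with h2 | h2
  · rw [h2]
    linarith
  · have := convex_comb_le h0 h1 hD (show Q.rejoinReward α x j j - v ≤ M by linarith)
    linarith

lemma expectedReward_eq_rejoinReward (hα : 0 < α) (hv : 0 ≤ v) (hy : 0 ≤ y) (hx : 0 ≤ x) {N : ℕ}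
    (hN : joinProb x (N + 1) = 0)
    (h : ∀ j, 1 ≤ j → j ≤ N → joinProb y j = 1 ∨ Q.rejoinReward α x j j = v) {i j : ℕ}
    (hij : 1 ≤ i ∧ i ≤ j ∧ j ≤ N) :
    Q.expectedReward α v y x (.inQueue i j) = Q.rejoinReward α x i j :=
  le_antisymm
    (Q.expectedReward_le_rejoinReward hα hv hy hx hN
      (fun j h1 h2 => (h j h1 h2).imp_right fun h3 => Or.inr h3.ge) hij)
    (Q.rejoinReward_le_expectedReward hα hv hy hx hN
      (fun j h1 h2 => (h j h1 h2).imp_right fun h3 => h3.le) hij)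

lemma zHat_nat (hα : 0 < α) {N : ℕ} (hN : 1 ≤ N) (hx : 0 ≤ x) (hxN : x ≤ N) :
    Q.zHat α v N x N = Q.rejoinReward α x N N - v := by
  rw [zHat_eq, Q.expectedReward_eq_rejoinReward hα zero_le_one (Nat.cast_nonneg N) hx
    (joinProb_eq_zero hx (by push_cast; linarith))
    (fun j _ hj => Or.inl (joinProb_eq_one (Nat.cast_nonneg N) (by exact_mod_cast hj)))
    ⟨hN, le_rfl, le_rfl⟩]

/-- Nobody joins behind, and nobody rejoins, when the last position is not acceptable. -/
lemma expectedReward_diag_succ (hα : 0 ≤ α) (hv : 0 ≤ v) (hy : 0 ≤ y) (hx : 0 ≤ x) {i : ℕ}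
    (hi : 1 ≤ i) (h : joinProb x (i + 1) = 0) :
    (1 - Q.eventDiscount α * Q.arrivalProb) *
      Q.expectedReward α v y x (.inQueue (i + 1) (i + 1)) =
    Q.eventDiscount α * (1 - Q.arrivalProb) * Q.expectedReward α v y x (.inQueue i i) := by
  have h2 : joinProb x (i + 1 + 1) = 0 :=
    le_antisymm (h ▸ joinProb_antitone hx (Nat.le_succ _)) (joinProb_nonneg hx _)
  have h1 := Q.expectedReward_inQueue hα hv hy hx (i + 1) (i + 1)
  rw [valueStep_succ _ _ _ _ _ _ hi, h, h2] at h1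
  simp only [Nat.add_sub_cancel] at h1
  linear_combination h1

lemma rejoinReward_diag_succ (hα : 0 ≤ α) (hx : 0 ≤ x) {i : ℕ}
    (hi : 1 ≤ i) (h : joinProb x (i + 1) = 0) :
    (1 - Q.eventDiscount α * Q.arrivalProb) * Q.rejoinReward α x (i + 1) (i + 1) =
    Q.eventDiscount α * (1 - Q.arrivalProb) * Q.rejoinReward α x i i := by
  have h2 : joinProb x (i + 1 + 1) = 0 :=
    le_antisymm (h ▸ joinProb_antitone hx (Nat.le_succ _)) (joinProb_nonneg hx _)
  have h1 : Q.rejoinReward α x (i + 1) (i + 1) = _ :=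
    (Q.isValueData hα hx).rejoinValue_eq (show 1 ≤ i + 1 by omega) le_rfl
  rw [rejoinStep, valueStep_succ _ _ _ _ _ _ hi, h, h2] at h1
  simp only [Nat.add_sub_cancel] at h1
  unfold rejoinReward at h1 ⊢
  linear_combination h1

/-- Behind position N nobody joins or rejoins, so moving one place back only adds discounted
waiting, and v ≥ 0 keeps the bound. -/
lemma expectedReward_diag_le (hα : 0 ≤ α) (hv : 0 ≤ v) (hy : 0 ≤ y) (hx : 0 ≤ x) {N : ℕ}
    (hN : 1 ≤ N) (h : joinProb x (N + 1) = 0)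
    (hle : Q.expectedReward α v y x (.inQueue N N) ≤ v) {i : ℕ} (hi : N ≤ i) :
    Q.expectedReward α v y x (.inQueue i i) ≤ v := by
  have hd := Q.isValueData hα hx
  induction i, hi using Nat.le_induction with
  | base => exact hle
  | succ i hi ih =>
    have h2 : joinProb x (i + 1) = 0 :=
      le_antisymm (h ▸ joinProb_antitone hx (by omega)) (joinProb_nonneg hx _)
    have h1 := Q.expectedReward_diag_succ hα hv hy hx (hN.trans hi) h2
    have hb : Q.eventDiscount α * (1 - Q.arrivalProb) ≤
        1 - Q.eventDiscount α * Q.arrivalProb := by linarith [hd.b_le_one]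
    refine le_of_mul_le_mul_left ?_ hd.one_sub_pos
    rw [h1]
    calc _ ≤ Q.eventDiscount α * (1 - Q.arrivalProb) * v :=
          mul_le_mul_of_nonneg_left ih (mul_nonneg hd.b_pos.le (by linarith [hd.p_lt_one]))
      _ ≤ _ := mul_le_mul_of_nonneg_right hb hv

lemma isNashThreshold_of_rejoinReward (hα : 0 < α) (hv : 0 ≤ v) (hx : 0 ≤ x) {N : ℕ} (hN : 1 ≤ N)
    (h0 : joinProb x (N + 1) = 0) (h1 : ∀ j < N, joinProb x j = 1)
    (hle : v ≤ Q.rejoinReward α x N N) (h2 : joinProb x N = 1 ∨ Q.rejoinReward α x N N = v)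
    (h3 : Q.rejoinReward α x (N + 1) (N + 1) ≤ v) : Q.IsNashThreshold α v x := by
  have hd := Q.isValueData hα.le hx
  have hge (j : ℕ) (hj : 1 ≤ j) (hjN : j ≤ N) : v ≤ Q.rejoinReward α x j j :=
    hle.trans (hd.rejoinValue_diag_antitone hj hjN)
  refine ⟨hx, fun i hi y hy => ?_⟩
  rw [payoff_eq, payoff_eq]
  have ht0 := joinProb_nonneg hy i
  have ht1 := joinProb_le_one y i
  have hupper {i j : ℕ} (hij : 1 ≤ i ∧ i ≤ j ∧ j ≤ N) :=
    Q.expectedReward_le_rejoinReward hα hv hy hx h0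
      (fun j hj hjN => Or.inr (Or.inr (hge j hj hjN))) hij
  rcases le_or_gt i N with hiN | hiN
  · have hself : Q.expectedReward α v x x (.inQueue i i) = Q.rejoinReward α x i i := by
      refine Q.expectedReward_eq_rejoinReward hα hv hx hx h0 (fun j _ hjN => ?_)
        ⟨hi, le_rfl, hiN⟩
      rcases hjN.eq_or_lt with rfl | hlt
      · exact h2
      · exact Or.inl (h1 j hlt)
    have hxi : joinProb x i * (Q.rejoinReward α x i i - v) = Q.rejoinReward α x i i - v := by
      rcases hiN.eq_or_lt with rfl | hlt
      · rcases h2 with h2 | h2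
        · rw [h2, one_mul]
        · rw [h2, sub_self, mul_zero]
      · rw [h1 i hlt, one_mul]
    rw [hself, hxi]
    have h4 := hge i hi hiN
    calc _ ≤ joinProb y i * (Q.rejoinReward α x i i - v) :=
          mul_le_mul_of_nonneg_left (sub_le_sub_right (hupper ⟨hi, le_rfl, hiN⟩) _) ht0
      _ ≤ _ := mul_le_of_le_one_left (by linarith) ht1
  · have hzero : joinProb x i = 0 :=
      le_antisymm (h0 ▸ joinProb_antitone hx hiN) (joinProb_nonneg hx _)
    have hzero' : joinProb x (N + 1 + 1) = 0 :=
      le_antisymm (h0 ▸ joinProb_antitone hx (Nat.le_succ _)) (joinProb_nonneg hx _)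
    have hbase : Q.expectedReward α v y x (.inQueue (N + 1) (N + 1)) ≤ v := by
      refine le_trans ?_ h3
      refine le_of_mul_le_mul_left ?_ hd.one_sub_pos
      rw [Q.expectedReward_diag_succ hα.le hv hy hx hN h0,
        Q.rejoinReward_diag_succ hα.le hx hN h0]
      exact mul_le_mul_of_nonneg_left (hupper ⟨hN, le_rfl, le_rfl⟩)
        (mul_nonneg hd.b_pos.le (by linarith [hd.p_lt_one]))
    have h4 := Q.expectedReward_diag_le hα.le hv hy hx (by omega) hzero' hbase
      (show N + 1 ≤ i from hiN)
    rw [hzero, zero_mul]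
    exact mul_nonpos_of_nonneg_of_nonpos ht0 (by linarith)

lemma rejoinReward_le_of_isNashThreshold (hα : 0 < α) (hv : 0 ≤ v)
    (h : Q.IsNashThreshold α v x) : Q.rejoinReward α x (⌊x⌋₊ + 1) (⌊x⌋₊ + 1) ≤ v := by
  obtain ⟨hx, h⟩ := h
  set N := ⌊x⌋₊ + 1 with hNdef
  have hN : 1 ≤ N := by omega
  have hNx : x < N := by rw [hNdef]; push_cast; exact Nat.lt_floor_add_one x
  have h0 : joinProb x (N + 1) = 0 := joinProb_eq_zero hx (by push_cast; linarith)
  have hN0 : (0 : ℝ) ≤ N := Nat.cast_nonneg N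
  -- The deviation to threshold N always accepts and earns G_x(N, N) - v at position N. If this is
  -- positive, x must also earn it, yet it accepts position N with probability below 1 and its
  -- reward there is at most G_x(N, N).
  have h1 := h N hN N hN0
  rw [payoff_eq, payoff_eq, joinProb_eq_one hN0 le_rfl, one_mul,
    Q.expectedReward_eq_rejoinReward hα hv hN0 hx h0
      (fun j _ hj => Or.inl (joinProb_eq_one hN0 (by exact_mod_cast hj)))
      ⟨hN, le_rfl, le_rfl⟩] at h1
  by_contra! hlt
  have hf0 := joinProb_nonneg hx N
  have hf1 := joinProb_lt_one hx hNx
  have hF : v < Q.expectedReward α v x x (.inQueue N N) := by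
    by_contra! hle
    have := mul_nonpos_of_nonneg_of_nonpos hf0 (sub_nonpos.2 hle)
    linarith
  have h2 := Q.expectedReward_le_rejoinReward hα hv hx hx h0 (fun j _ hj => ?_)
    ⟨hN, le_rfl, le_rfl⟩
  · nlinarith
  · rcases hj.eq_or_lt with rfl | hj
    · exact Or.inr (Or.inl hF.le)
    · refine Or.inl (joinProb_eq_one hx ?_)
      exact le_trans (by exact_mod_cast (show j ≤ ⌊x⌋₊ by omega)) (Nat.floor_le hx)

lemma le_rejoinReward_of_isNashThreshold (hα : 0 < α) (hv : 0 ≤ v)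
    (h : Q.IsNashThreshold α v x) (hx0 : 0 < x) : v ≤ Q.rejoinReward α x ⌈x⌉₊ ⌈x⌉₊ := by
  obtain ⟨hx, h⟩ := h
  set N := ⌈x⌉₊ with hNdef
  have hN : 1 ≤ N := Nat.one_le_iff_ne_zero.2 (Nat.ceil_pos.2 hx0).ne'
  have hxN : x ≤ N := Nat.le_ceil x
  have hNx : (N : ℝ) < x + 1 := Nat.ceil_lt_add_one hx
  have h0 : joinProb x (N + 1) = 0 := joinProb_eq_zero hx (by push_cast; linarith)
  -- Deviating to threshold 0 earns nothing, so accepting position N must not lose; x accepts it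
  -- with positive probability.
  have h1 := h N hN 0 le_rfl
  rw [payoff_eq, payoff_eq, joinProb_eq_zero le_rfl (by norm_num; exact hN), zero_mul] at h1
  have hF := sub_nonneg.1 (nonneg_of_mul_nonneg_right h1 (joinProb_pos hx hNx))
  refine hF.trans (Q.expectedReward_le_rejoinReward hα hv hx hx h0 (fun j _ hj => ?_)
    ⟨hN, le_rfl, le_rfl⟩)
  rcases hj.eq_or_lt with rfl | hj
  · exact Or.inr (Or.inl hF)
  · exact Or.inl (joinProb_eq_one hx (Nat.lt_ceil.1 hj).le)

end FeedbackQueue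

/-! ### Monotonicity and continuity in the threshold of the others. -/

namespace FeedbackQueue

variable (Q : FeedbackQueue) {α v x x' y : ℝ}

lemma rejoinReward_anti (hα : 0 < α) (hx : 0 ≤ x) (hxx' : x ≤ x') {i j : ℕ} (hi : 1 ≤ i)
    (hij : i ≤ j) : Q.rejoinReward α x' i j ≤ Q.rejoinReward α x i j := by
  obtain ⟨N, hN⟩ := exists_nat_ge (max x' j)
  refine (Q.isValueData hα.le hx).rejoinValue_anti (Q.isValueData hα.le (hx.trans hxx'))
    (Q.eventDiscount_lt_one hα) (joinProb_mono hx hxx') (N := N)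
    (joinProb_eq_zero (hx.trans hxx') ?_) i j ⟨hi, hij, ?_⟩
  · push_cast
    linarith [(le_max_left _ _).trans hN]
  · exact_mod_cast (le_max_right _ _).trans hN

lemma rejoinReward_lt (hα : 0 < α) (hq : Q.q < 1) {n : ℕ} (hn : 1 ≤ n) (hnx : n ≤ x)
    (hxx' : x < x') (hx' : x' ≤ n + 1) :
    Q.rejoinReward α x' (n + 1) (n + 1) < Q.rejoinReward α x (n + 1) (n + 1) := by
  have hx : 0 ≤ x := (Nat.cast_nonneg n).trans hnx
  refine (Q.isValueData hα.le hx).rejoinValue_lt (Q.isValueData hα.le (hx.trans hxx'.le))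
    (Q.eventDiscount_lt_one hα) hq (joinProb_mono hx hxx'.le) (N := n + 1)
    (joinProb_eq_zero (hx.trans hxx'.le) (by push_cast; linarith)) hn le_rfl ?_
  rw [joinProb_eq hx, joinProb_eq (hx.trans hxx'.le)]
  push_cast
  rw [min_eq_right (by linarith), min_eq_right (by linarith), max_eq_right (by linarith),
    max_eq_right (by linarith)]
  linarith

lemma continuousOn_rejoinReward (hα : 0 < α) {i j : ℕ} (hi : 1 ≤ i) (hij : i ≤ j) :
    ContinuousOn (fun x => Q.rejoinReward α x i j) (Set.Ici 0) := by
  have hb : 0 < 1 - Q.eventDiscount α := sub_pos.2 (Q.eventDiscount_lt_one hα)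
  have key (x x' : ℝ) (hx : 0 ≤ x) (hx' : 0 ≤ x') :
      Q.rejoinReward α x i j - Q.rejoinReward α x' i j ≤
        |x - x'| / (1 - Q.eventDiscount α) := by
    obtain ⟨N, hN⟩ := exists_nat_ge (max x' j)
    refine (Q.isValueData hα.le hx).rejoinValue_sub_le (Q.isValueData hα.le hx')
      (Q.eventDiscount_lt_one hα) (abs_nonneg _) (abs_joinProb_sub_le hx hx') (N := N)
      (joinProb_eq_zero hx' ?_) i j ⟨hi, hij, ?_⟩
    · push_cast
      linarith [(le_max_left _ _).trans hN]
    · exact_mod_cast (le_max_right _ _).trans hN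
  refine (LipschitzOnWith.of_dist_le_mul (K := (1 / (1 - Q.eventDiscount α)).toNNReal)
    fun x hx x' hx' => ?_).continuousOn
  rw [Real.coe_toNNReal _ (by positivity), Real.dist_eq, Real.dist_eq, one_div_mul_eq_div, abs_le]
  have h1 := key x x' hx hx'
  have h2 := key x' x hx' hx
  rw [abs_sub_comm] at h2
  constructor <;> linarith

/-- Position 2 is never accepted when x ≤ 1, so the recursion closes at (1, 1) and x drops out of
it. -/
lemma rejoinReward_one_one (hα : 0 ≤ α) (hx : 0 ≤ x) (hx1 : x ≤ 1) :
    (1 - Q.eventDiscount α * (Q.arrivalProb + (1 - Q.arrivalProb) * (1 - Q.q))) *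
      Q.rejoinReward α x 1 1 = Q.eventDiscount α * ((1 - Q.arrivalProb) * Q.q) := by
  have h1 : Q.rejoinReward α x 1 1 = _ := (Q.isValueData hα hx).rejoinValue_eq le_rfl le_rfl
  rw [rejoinStep, valueStep_one, joinProb_eq_zero hx (by norm_num; linarith)] at h1
  unfold rejoinReward at h1 ⊢
  linear_combination h1

lemma one_sub_discount_pos (hα : 0 ≤ α) :
    0 < 1 - Q.eventDiscount α * (Q.arrivalProb + (1 - Q.arrivalProb) * (1 - Q.q)) := by
  have hd := Q.isValueData hα le_rfl
  have h1 : 0 < (1 - Q.arrivalProb) * Q.q := mul_pos (by linarith [hd.p_lt_one]) hd.q_pos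
  have h2 : 0 ≤ Q.arrivalProb + (1 - Q.arrivalProb) * (1 - Q.q) :=
    add_nonneg hd.p_pos.le (mul_nonneg (by linarith [hd.p_lt_one]) (by linarith [hd.q_le_one]))
  have h3 := mul_le_of_le_one_left h2 hd.b_le_one
  linarith

lemma rejoinReward_one_one_eq (hα : 0 ≤ α) (hx : 0 ≤ x) (hx1 : x ≤ 1) :
    Q.rejoinReward α x 1 1 = Q.rejoinReward α 0 1 1 :=
  mul_left_cancel₀ (Q.one_sub_discount_pos hα).ne'
    ((Q.rejoinReward_one_one hα hx hx1).trans
      (Q.rejoinReward_one_one hα le_rfl zero_le_one).symm)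

/-- Two different equilibrium thresholds exist only in degenerate situations. -/
lemma exists_of_isNashThreshold_lt (hα : 0 < α) (hv : 0 ≤ v) (h : Q.IsNashThreshold α v x)
    (h' : Q.IsNashThreshold α v x') (hlt : x < x') :
    ∃ n : ℕ, (n : ℝ) ≤ x ∧ x' ≤ n + 1 ∧ Q.rejoinReward α x (n + 1) (n + 1) = v ∧
      (n = 0 ∨ Q.q = 1) := by
  have hx := h.1
  have hx' := h'.1
  have hd' := Q.isValueData hα.le hx'
  have h1 := Q.rejoinReward_le_of_isNashThreshold hα hv h
  have h2 := Q.le_rejoinReward_of_isNashThreshold hα hv h' (hx.trans_lt hlt)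
  -- The chain v ≤ G_x'(⌈x'⌉, ⌈x'⌉) ≤ G_x'(⌊x⌋+1, ⌊x⌋+1) ≤ G_x(⌊x⌋+1, ⌊x⌋+1) ≤ v collapses to
  -- equalities. Strict diagonal decrease then identifies ⌈x'⌉ with ⌊x⌋ + 1, and strict decrease in
  -- x excludes n ≥ 1 with q < 1.
  have h3 : ⌊x⌋₊ + 1 ≤ ⌈x'⌉₊ := by
    rw [Nat.succ_le_iff, Nat.lt_ceil]
    exact (Nat.floor_le hx).trans_lt hlt
  have h4 := Q.rejoinReward_anti hα hx hlt.le (i := ⌊x⌋₊ + 1) (by omega) le_rfl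
  have h5 : ⌈x'⌉₊ = ⌊x⌋₊ + 1 := by
    refine (h3.antisymm ?_).symm
    by_contra! h6
    have : Q.rejoinReward α x' _ _ < _ :=
      hd'.rejoinValue_diag_strictAnti (Q.eventDiscount_lt_one hα) (by omega) h6
    exact absurd (h2.trans_lt (this.trans_le (h4.trans h1))) (lt_irrefl _)
  rw [h5] at h2
  have hx'n : x' ≤ ⌊x⌋₊ + 1 := by
    have := Nat.le_ceil x'
    rw [h5] at this
    exact_mod_cast this
  refine ⟨⌊x⌋₊, Nat.floor_le hx, hx'n, le_antisymm h1 (h2.trans h4), ?_⟩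
  by_contra! hne
  have := Q.rejoinReward_lt hα (lt_of_le_of_ne Q.q_le_one hne.2) (Nat.one_le_iff_ne_zero.2 hne.1)
    (Nat.floor_le hx) hlt hx'n
  linarith

/-! ### The undiscounted case and the empty-queue equilibrium. -/

/-- Without discounting, the tagged customer leaves the system almost surely. -/
lemma expectedReward_of_no_discount (hy : 0 ≤ y) (hx : 0 ≤ x) {i j : ℕ} (hi : 1 ≤ i)
    (hij : i ≤ j) : Q.expectedReward 0 1 y x (.inQueue i j) = 1 := by
  have hd := Q.isValueData le_rfl hx
  obtain ⟨N, hN⟩ := exists_nat_ge (max x j)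
  have h0 : joinProb x (N + 1) = 0 :=
    joinProb_eq_zero hx (by push_cast; linarith [(le_max_left _ _).trans hN])
  have hjN : j ≤ N := by exact_mod_cast (le_max_right _ _).trans hN
  have hF (i j : ℕ) := Q.expectedReward_inQueue (α := 0) le_rfl zero_le_one hy hx i j
  have hb : Q.eventDiscount 0 = 1 := by
    rw [eventDiscount, add_zero]
    exact div_self (add_pos Q.lam_pos Q.mu_pos).ne'
  rw [hb] at hF
  set F : ℕ → ℕ → ℝ := fun i j => Q.expectedReward 0 1 y x (.inQueue i j) with hFdef
  set p := Q.arrivalProb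
  set q := Q.q
  have hp0 := hd.p_pos.le
  have hp1 : 0 < 1 - p := by linarith [hd.p_lt_one]
  have hq0 := hd.q_pos
  set ε := (1 - p) * q with hε
  have hε0 : 0 < ε := mul_pos hp1 hq0
  have hε1 : ε ≤ 1 := mul_le_one₀ (by linarith) hq0.le hd.q_le_one
  have hle1 (i j : ℕ) : F i j ≤ 1 := by
    simpa using Q.expectedReward_le (α := 0) le_rfl zero_le_one y x (.inQueue i j)
  refine le_antisymm (hle1 i j) ?_
  -- Here ε is the probability that an event is a successful service. From position i ≤ N, i such
  -- events in a row end the sojourn, so the probability ε ^ N of exit replaces discounting as the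
  -- source of contraction.
  have key := nonpos_of_le_mul_bound (S := fun i j => 1 ≤ i ∧ i ≤ j ∧ j ≤ N)
    (D := fun i j => 1 - F i j) (κ := 1 - ε ^ N) (B := 1)
    (by linarith [pow_le_one₀ (n := N) hε0.le hε1]) (by linarith [pow_pos hε0 N])
    (fun i j _ => by
      have : 0 ≤ F i j := Q.expectedReward_nonneg le_rfl zero_le_one y x _
      linarith) ?_ i j ⟨hi, hij, hjN⟩
  · linarith
  intro M hM hD i j hij
  have hA (i j : ℕ) (hij : 1 ≤ i ∧ i ≤ j ∧ j ≤ N) :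
      joinProb x (j + 1) * (1 - F i (j + 1)) + (1 - joinProb x (j + 1)) * (1 - F i j) ≤ M := by
    rcases hij.2.2.eq_or_lt with rfl | hlt
    · rw [h0]
      simpa using hD i j hij
    · exact convex_comb_le (joinProb_nonneg hx _) (joinProb_le_one x _)
        (hD _ _ ⟨hij.1, by omega, hlt⟩) (hD _ _ hij)
  have main : ∀ i, 1 ≤ i → ∀ j, i ≤ j → j ≤ N → 1 - F i j ≤ (1 - ε ^ i) * M := by
    intro i hi
    induction i, hi using Nat.le_induction with
    | base =>
      intro j hij hjN
      have h1 := hF 1 j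
      rw [valueStep_one] at h1
      -- Reneging also pays 1 here, so only the rejoining branch leaves a deficit.
      have h2 : joinProb y j * (1 - F j j) ≤ M :=
        (mul_le_of_le_one_left (by linarith [hle1 j j]) (joinProb_le_one y j)).trans
          (hD j j ⟨hij, le_rfl, hjN⟩)
      have h3 := mul_le_mul_of_nonneg_left (hA 1 j ⟨le_rfl, hij, hjN⟩) hp0
      have h4 := mul_le_mul_of_nonneg_left h2
        (mul_nonneg hp1.le (show 0 ≤ 1 - q by linarith [hd.q_le_one]))
      calc 1 - F 1 j = p * (joinProb x (j + 1) * (1 - F 1 (j + 1)) +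
            (1 - joinProb x (j + 1)) * (1 - F 1 j)) +
              (1 - p) * (1 - q) * (joinProb y j * (1 - F j j)) := by
            linear_combination -h1
        _ ≤ p * M + (1 - p) * (1 - q) * M := add_le_add h3 h4
        _ = (1 - ε ^ 1) * M := by rw [hε]; ring
    | succ k hk ih =>
      intro j hij hjN
      have h1 := hF (k + 1) j
      rw [valueStep_succ _ _ _ _ _ _ hk] at h1
      have h2 := ih (j - 1) (by omega) (by omega)
      have h5 := convex_comb_le (joinProb_nonneg hx j) (joinProb_le_one x j)
        (hD k j ⟨hk, by omega, hjN⟩) (hD k (j - 1) ⟨hk, by omega, by omega⟩)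
      have h3 := mul_le_mul_of_nonneg_left (hA (k + 1) j ⟨by omega, hij, hjN⟩) hp0
      have h4 := mul_le_mul_of_nonneg_left h5
        (mul_nonneg hp1.le (show 0 ≤ 1 - q by linarith [hd.q_le_one]))
      have h6 := mul_le_mul_of_nonneg_left h2 hε0.le
      calc 1 - F (k + 1) j = p * (joinProb x (j + 1) * (1 - F (k + 1) (j + 1)) +
            (1 - joinProb x (j + 1)) * (1 - F (k + 1) j)) + ε * (1 - F k (j - 1)) +
              (1 - p) * (1 - q) * (joinProb x j * (1 - F k j) +
                (1 - joinProb x j) * (1 - F k (j - 1))) := by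
            rw [hε]
            linear_combination -h1
        _ ≤ p * M + ε * ((1 - ε ^ k) * M) + (1 - p) * (1 - q) * M :=
            add_le_add (add_le_add h3 h6) h4
        _ = (1 - ε ^ (k + 1)) * M := by rw [pow_succ, hε]; ring
  refine (main i hij.1 j hij.2.1 hij.2.2).trans (mul_le_mul_of_nonneg_right ?_ hM)
  have := pow_le_pow_of_le_one hε0.le hε1 (show i ≤ N by omega)
  linarith

lemma zHat_of_no_discount (v : ℝ) (hy : 0 ≤ y) (hx : 0 ≤ x) {i : ℕ} (hi : 1 ≤ i) :
    Q.zHat 0 v y x i = 1 - v := by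
  rw [zHat_eq, Q.expectedReward_of_no_discount hy hx hi le_rfl]

lemma isNashThreshold_of_no_discount (hx : 0 ≤ x) : Q.IsNashThreshold 0 1 x := by
  refine ⟨hx, fun i hi y hy => ?_⟩
  rw [payoff_eq, payoff_eq, Q.expectedReward_of_no_discount hy hx hi le_rfl,
    Q.expectedReward_of_no_discount hx hx hi le_rfl]
  simp

/-- This supplies the condition v ≥ 0 of the comparison arguments in all four cases. -/
lemma nonneg_of_zHat_nonpos (hα : 0 ≤ α) {i : ℕ} (h : Q.zHat α v y x i ≤ 0) : 0 ≤ v := by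
  rw [zHat_eq] at h
  linarith [Q.expectedReward_nonneg hα zero_le_one y x (.inQueue i i)]

lemma isNashThreshold_zero (hα : 0 ≤ α) (h : Q.zHat α v 1 0 1 ≤ 0) :
    Q.IsNashThreshold α v 0 := by
  have hv := Q.nonneg_of_zHat_nonpos hα h
  have hd := Q.isValueData hα le_rfl
  refine ⟨le_rfl, fun i hi y hy => ?_⟩
  have h2 : joinProb 0 (1 + 1) = 0 := joinProb_eq_zero le_rfl (by norm_num)
  -- With x = 0 the recursion closes at (1, 1), so α = 0 needs no contraction: F is a weighted
  -- average of g and v, and g ≤ v.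
  have h1 : Q.expectedReward α v y 0 (.inQueue 1 1) ≤ v := by
    have hg := Q.expectedReward_inQueue hα zero_le_one zero_le_one (le_refl (0 : ℝ)) 1 1
    have hF := Q.expectedReward_inQueue hα hv hy (le_refl (0 : ℝ)) 1 1
    rw [valueStep_one, h2] at hg hF
    rw [joinProb_eq_one zero_le_one (by simp)] at hg
    rw [zHat_eq, sub_nonpos] at h
    have hA := Q.one_sub_discount_pos hα
    set b := Q.eventDiscount α
    set p := Q.arrivalProb
    set q := Q.q
    set g := Q.expectedReward α 1 1 0 (.inQueue 1 1)
    set F := Q.expectedReward α v y 0 (.inQueue 1 1)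
    set t := joinProb y 1
    have hAv := mul_le_mul_of_nonneg_left h hA.le
    have hbt : 0 ≤ b * (1 - p) * (1 - q) * (1 - t) :=
      mul_nonneg (mul_nonneg (mul_nonneg hd.b_pos.le (by linarith [hd.p_lt_one]))
        (by linarith [hd.q_le_one])) (by linarith [joinProb_le_one y 1])
    have hpos : 0 < 1 - b * (p + (1 - p) * (1 - q)) + b * (1 - p) * (1 - q) * (1 - t) := by
      linarith
    refine le_of_mul_le_mul_left ?_ hpos
    calc _ = b * ((1 - p) * q) + b * (1 - p) * (1 - q) * (1 - t) * v := by
          linear_combination hF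
      _ = (1 - b * (p + (1 - p) * (1 - q))) * g + b * (1 - p) * (1 - q) * (1 - t) * v := by
          linear_combination -hg
      _ ≤ _ := by linarith
  have h3 := Q.expectedReward_diag_le hα hv hy le_rfl le_rfl h2 h1 hi
  have hi' : (1 : ℝ) ≤ i := by exact_mod_cast hi
  rw [payoff_eq, payoff_eq, joinProb_eq_zero le_rfl (by linarith), zero_mul]
  exact mul_nonpos_of_nonneg_of_nonpos (joinProb_nonneg hy i) (by linarith)

/-- Without discounting, an outside option worth more than a service keeps everybody out. -/
lemma eq_zero_of_isNashThreshold_of_no_discount (hv : 1 < v) (h : Q.IsNashThreshold 0 v x) :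
    x = 0 := by
  obtain ⟨hx, h⟩ := h
  by_contra hne
  have hpos : 0 < x := lt_of_le_of_ne hx (Ne.symm hne)
  have hv0 : 0 ≤ v := by linarith
  have hd := Q.isValueData (le_refl (0 : ℝ)) hx
  have h1 := h 1 le_rfl 0 le_rfl
  rw [payoff_eq, payoff_eq, joinProb_eq_zero le_rfl (by norm_num), zero_mul] at h1
  have hF := sub_nonneg.1 (nonneg_of_mul_nonneg_right h1
    (joinProb_pos hx (by push_cast; linarith)))
  have hle (i j : ℕ) : Q.expectedReward 0 v x x (.inQueue i j) ≤ v := by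
    simpa [hv.le] using Q.expectedReward_le (α := 0) le_rfl hv0 x x (.inQueue i j)
  have hrec := Q.expectedReward_inQueue le_rfl hv0 hx hx 1 1
  rw [valueStep_one] at hrec
  have hA := convex_comb_le (joinProb_nonneg hx (1 + 1)) (joinProb_le_one x (1 + 1))
    (hle 1 (1 + 1)) (hle 1 1)
  have hB := convex_comb_le (joinProb_nonneg hx 1) (joinProb_le_one x 1) (hle 1 1) (le_refl v)
  have hq := hd.q_pos
  have hp1 : 0 < 1 - Q.arrivalProb := by linarith [hd.p_lt_one]
  have hS : Q.q + (1 - Q.q) * (joinProb x 1 * Q.expectedReward 0 v x x (.inQueue 1 1) +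
      (1 - joinProb x 1) * v) < v := by
    have := mul_le_mul_of_nonneg_left hB (show 0 ≤ 1 - Q.q by linarith [hd.q_le_one])
    have := mul_lt_mul_of_pos_left hv hq
    linarith
  have h2 := mul_lt_mul_of_pos_left hS hp1
  have h3 := mul_le_mul_of_nonneg_left hA hd.p_pos.le
  have hb : Q.eventDiscount 0 = 1 := by
    rw [eventDiscount, add_zero]
    exact div_self (add_pos Q.lam_pos Q.mu_pos).ne'
  rw [hb, one_mul] at hrec
  linarith

/-! ### The four cases and their coverage. -/

lemma setOf_isNashThreshold_eq_zero (hα : 0 ≤ α) (h : Q.zHat α v 1 0 1 < 0) :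
    {x : ℝ | Q.IsNashThreshold α v x} = {0} := by
  have hv := Q.nonneg_of_zHat_nonpos hα h.le
  refine Set.eq_singleton_iff_unique_mem.2 ⟨Q.isNashThreshold_zero hα h.le, fun x hx => ?_⟩
  rw [Set.mem_ofPred_eq] at hx
  rcases hα.eq_or_lt with rfl | hα
  · rw [Q.zHat_of_no_discount v zero_le_one le_rfl le_rfl] at h
    exact Q.eq_zero_of_isNashThreshold_of_no_discount (by linarith) hx
  by_contra hne
  have hpos : 0 < x := lt_of_le_of_ne hx.1 (Ne.symm hne)
  have h1 := Q.le_rejoinReward_of_isNashThreshold hα hv hx hpos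
  have h2 : Q.rejoinReward α x _ _ ≤ _ := (Q.isValueData hα.le hx.1).rejoinValue_diag_antitone
    le_rfl (Nat.one_le_iff_ne_zero.2 (Nat.ceil_pos.2 hpos).ne')
  have h3 := Q.rejoinReward_anti hα le_rfl hx.1 (le_refl 1) (le_refl 1)
  have h4 := Q.zHat_nat (v := v) hα (le_refl 1) le_rfl (by simp)
  rw [Nat.cast_one] at h4
  unfold rejoinReward at *
  linarith

lemma isNashThreshold_of_mem_Icc (hα : 0 < α) (hv : 0 ≤ v) {n : ℕ} (hnx : (n : ℝ) ≤ x)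
    (hxn : x ≤ n + 1) (h : Q.rejoinReward α x (n + 1) (n + 1) = v) :
    Q.IsNashThreshold α v x := by
  have hx : 0 ≤ x := (Nat.cast_nonneg n).trans hnx
  refine Q.isNashThreshold_of_rejoinReward hα hv hx (N := n + 1) (by omega)
    (joinProb_eq_zero hx (by push_cast; linarith)) (fun j hj => joinProb_eq_one hx ?_) h.ge
    (Or.inr h) ?_
  · exact le_trans (by exact_mod_cast Nat.lt_succ_iff.1 hj) hnx
  · exact ((Q.isValueData hα.le hx).rejoinInvariant_value.anti_diag _ (by omega)).trans h.le

lemma isNashThreshold_of_zHat_one_eq_zero (hα : 0 ≤ α) (h : Q.zHat α v 1 0 1 = 0)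
    (hx : 0 ≤ x) (hx1 : x ≤ 1) : Q.IsNashThreshold α v x := by
  rcases hα.eq_or_lt with rfl | hα
  · rw [Q.zHat_of_no_discount v zero_le_one le_rfl le_rfl] at h
    obtain rfl : v = 1 := by linarith
    exact Q.isNashThreshold_of_no_discount hx
  · have hv := Q.nonneg_of_zHat_nonpos hα.le h.le
    have h4 := Q.zHat_nat (v := v) hα (le_refl 1) le_rfl (by simp)
    rw [Nat.cast_one, h] at h4
    refine Q.isNashThreshold_of_mem_Icc hα hv (n := 0) (by simpa) (by simpa) ?_
    rw [zero_add, Q.rejoinReward_one_one_eq hα.le hx hx1]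
    linarith

lemma le_one_of_isNashThreshold (hα : 0 < α) (h : Q.zHat α v 1 0 1 = 0)
    (hx : Q.IsNashThreshold α v x) : x ≤ 1 := by
  have hv := Q.nonneg_of_zHat_nonpos hα.le h.le
  by_contra! hlt
  have h0 := Q.isNashThreshold_zero hα.le h.le
  obtain ⟨n, h1, h2, -⟩ := Q.exists_of_isNashThreshold_lt hα hv h0 hx (by linarith)
  have : n = 0 := by exact_mod_cast le_antisymm h1 (Nat.cast_nonneg n)
  rw [this] at h2
  norm_num at h2
  linarith

lemma isNashThreshold_nat (hα : 0 ≤ α) {m : ℕ} (hm : 1 ≤ m)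
    (h1 : Q.zHat α v (m + 1) m (m + 1) ≤ 0) (h2 : 0 ≤ Q.zHat α v m m m) :
    Q.IsNashThreshold α v m := by
  have hm0 : (0 : ℝ) ≤ m := Nat.cast_nonneg m
  rcases hα.eq_or_lt with rfl | hα
  · rw [Q.zHat_of_no_discount v (by linarith) hm0 (by omega)] at h1
    rw [Q.zHat_of_no_discount v hm0 hm0 hm] at h2
    obtain rfl : v = 1 := by linarith
    exact Q.isNashThreshold_of_no_discount hm0
  · have hv := Q.nonneg_of_zHat_nonpos hα.le h1
    have e1 := Q.zHat_nat (v := v) hα (show 1 ≤ m + 1 by omega) hm0 (by push_cast; linarith)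
    have e2 := Q.zHat_nat (v := v) hα hm hm0 le_rfl
    push_cast at e1
    exact Q.isNashThreshold_of_rejoinReward hα hv hm0 hm
      (joinProb_eq_zero hm0 (by push_cast; linarith))
      (fun j hj => joinProb_eq_one hm0 (by exact_mod_cast hj.le)) (by linarith)
      (Or.inl (joinProb_eq_one hm0 le_rfl)) (by linarith)

/-- With q < 1, two equilibria could only share the cell [0, 1]. That requires G_0(1, 1) = v and
both thresholds at most 1, which `h0` rules out. -/
lemma eq_of_isNashThreshold (hα : 0 < α) (hv : 0 ≤ v) (hq : Q.q < 1)
    (h0 : Q.rejoinReward α 0 1 1 ≠ v ∨ 1 < x) (hx : Q.IsNashThreshold α v x)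
    (hx' : Q.IsNashThreshold α v x') : x' = x := by
  rcases lt_trichotomy x' x with hlt | heq | hlt
  · obtain ⟨n, h1, h2, h3, rfl | h4⟩ := Q.exists_of_isNashThreshold_lt hα hv hx' hx hlt
    · rw [Nat.cast_zero, zero_add] at h2
      rw [zero_add, Q.rejoinReward_one_one_eq hα.le hx'.1 (by linarith)] at h3
      rcases h0 with h0 | h0
      · exact absurd h3 h0
      · linarith
    · exact absurd h4 hq.ne
  · exact heq
  · obtain ⟨n, h1, h2, h3, rfl | h4⟩ := Q.exists_of_isNashThreshold_lt hα hv hx hx' hlt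
    · rw [Nat.cast_zero, zero_add] at h2
      rw [zero_add, Q.rejoinReward_one_one_eq hα.le hx.1 (by linarith)] at h3
      rcases h0 with h0 | h0
      · exact absurd h3 h0
      · linarith
    · exact absurd h4 hq.ne

lemma exists_unique_mixed (hα : 0 ≤ α) {m : ℕ} (hm : 1 ≤ m)
    (h1 : Q.zHat α v (m + 1) (m + 1) (m + 1) < 0) (h2 : 0 < Q.zHat α v (m + 1) m (m + 1)) :
    ∃ χ ∈ Set.Ioo (m : ℝ) (m + 1),
      {x ∈ Set.Ioo (m : ℝ) (m + 1) | Q.zHat α v (m + 1) x (m + 1) = 0} = {χ} ∧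
      {x : ℝ | Q.IsNashThreshold α v x} = {χ} := by
  have hm0 : (0 : ℝ) ≤ m := Nat.cast_nonneg m
  have hv := Q.nonneg_of_zHat_nonpos hα h1.le
  rcases hα.eq_or_lt with rfl | hα
  · rw [Q.zHat_of_no_discount v (by linarith) (by linarith) (by omega)] at h1
    rw [Q.zHat_of_no_discount v (by linarith) hm0 (by omega)] at h2
    linarith
  have e (x : ℝ) (hx : (m : ℝ) ≤ x) (hx' : x ≤ m + 1) :
      Q.zHat α v (m + 1) x (m + 1) = Q.rejoinReward α x (m + 1) (m + 1) - v := by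
    have := Q.zHat_nat (v := v) hα (show 1 ≤ m + 1 by omega) (hm0.trans hx)
      (show x ≤ (m + 1 : ℕ) by exact_mod_cast hx')
    exact_mod_cast this
  rw [e _ (by linarith) le_rfl] at h1
  rw [e _ le_rfl (by linarith)] at h2
  -- If q = 1, the value does not depend on the others, so it cannot lie on opposite sides of v at m
  -- and m + 1.
  have hq : Q.q < 1 := by
    refine lt_of_le_of_ne Q.q_le_one fun hq => ?_
    have d1 := Q.isValueData hα.le hm0
    have d2 := Q.isValueData hα.le (show (0 : ℝ) ≤ m + 1 by linarith)
    unfold rejoinReward at h1 h2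
    rw [hq] at d1 d2 h1 h2
    have := d1.rejoinValue_eq_of_forall_success d2 (Q.eventDiscount_lt_one hα) (N := m + 1)
      (joinProb_eq_zero hm0 (by push_cast; linarith))
      (joinProb_eq_zero (by linarith) (by push_cast; linarith)) (m + 1) (m + 1)
      ⟨by omega, le_rfl, le_rfl⟩
    linarith
  obtain ⟨χ, hχ, hχv⟩ : ∃ χ ∈ Set.Ioo (m : ℝ) (m + 1),
      Q.rejoinReward α χ (m + 1) (m + 1) = v := by
    have hc := (Q.continuousOn_rejoinReward hα (show 1 ≤ m + 1 by omega) le_rfl).mono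
      (show Set.Icc (m : ℝ) (m + 1) ⊆ Set.Ici 0 from fun x hx => hm0.trans hx.1)
    exact intermediate_value_Ioo' (by linarith) hc ⟨by linarith, by linarith⟩
  have hNash := Q.isNashThreshold_of_mem_Icc hα hv hχ.1.le hχ.2.le hχv
  have h1χ : 1 < χ := lt_of_le_of_lt (by exact_mod_cast hm) hχ.1
  have huniq (x : ℝ) (hx : Q.IsNashThreshold α v x) : x = χ :=
    Q.eq_of_isNashThreshold hα hv hq (Or.inr h1χ) hNash hx
  refine ⟨χ, hχ, Set.eq_singleton_iff_unique_mem.2 ⟨⟨hχ, ?_⟩, ?_⟩,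
    Set.eq_singleton_iff_unique_mem.2 ⟨hNash, huniq⟩⟩
  · rw [e _ hχ.1.le hχ.2.le, hχv, sub_self]
  -- Every root is itself an equilibrium, so uniqueness of the root follows from uniqueness of the
  -- equilibrium.
  · rintro x ⟨hx, hx0⟩
    rw [e _ hx.1.le hx.2.le, sub_eq_zero] at hx0
    exact huniq x (Q.isNashThreshold_of_mem_Icc hα hv hx.1.le hx.2.le hx0)

lemma exists_case (hα : 0 < α) (hv : 0 < v) (h0 : 0 < Q.zHat α v 1 0 1) :
    (∃ m : ℕ, 1 ≤ m ∧ Q.zHat α v (m + 1) m (m + 1) ≤ 0 ∧ 0 ≤ Q.zHat α v m m m) ∨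
    (∃ m : ℕ, 1 ≤ m ∧ Q.zHat α v (m + 1) (m + 1) (m + 1) < 0 ∧
      0 < Q.zHat α v (m + 1) m (m + 1)) := by
  have e1 (m : ℕ) : Q.zHat α v (m + 1) m (m + 1) =
      Q.rejoinReward α m (m + 1) (m + 1) - v := by
    have := Q.zHat_nat (v := v) hα (show 1 ≤ m + 1 by omega) (Nat.cast_nonneg m)
      (by push_cast; linarith)
    exact_mod_cast this
  have e2 (m : ℕ) : Q.zHat α v (m + 1) (m + 1) (m + 1) =
      Q.rejoinReward α (m + 1) (m + 1) (m + 1) - v := by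
    have := Q.zHat_nat (v := v) hα (show 1 ≤ m + 1 by omega)
      (show (0 : ℝ) ≤ m + 1 by positivity) (by push_cast; linarith)
    exact_mod_cast this
  classical
  -- The diagonal value decays geometrically at a rate independent of the threshold, so it
  -- eventually drops below v > 0.
  have hex : ∃ m : ℕ, Q.zHat α v (m + 1) m (m + 1) ≤ 0 := by
    have hd := Q.isValueData hα.le le_rfl
    have hlt : Q.eventDiscount α * (1 - Q.arrivalProb) /
        (1 - Q.eventDiscount α * Q.arrivalProb) < 1 := by
      rw [div_lt_one hd.one_sub_pos]
      linarith [Q.eventDiscount_lt_one hα]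
    obtain ⟨m, hm⟩ := exists_pow_lt_of_lt_one hv hlt
    refine ⟨m, ?_⟩
    have : Q.rejoinReward α m (m + 1) (m + 1) ≤ _ :=
      (Q.isValueData hα.le (Nat.cast_nonneg m)).rejoinValue_diag_le_pow m
    rw [e1]
    linarith
  set m := Nat.find hex with hmdef
  have hm := Nat.find_spec hex
  have hmin (k : ℕ) (hk : k < m) : 0 < Q.zHat α v (k + 1) k (k + 1) :=
    not_le.1 (Nat.find_min hex hk)
  rw [← hmdef] at hm
  have hm1 : 1 ≤ m := by
    rw [Nat.one_le_iff_ne_zero]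
    intro hm0
    rw [hm0] at hm
    norm_num at hm
    linarith
  obtain ⟨k, hk⟩ := exists_eq_add_one_of_pos hm1
  have hcast : (m : ℝ) = k + 1 := by rw [hk]; push_cast; ring
  by_cases hge : 0 ≤ Q.zHat α v m m m
  · exact Or.inl ⟨m, hm1, hm, hge⟩
  · have hlt : Q.zHat α v (k + 1) (k + 1) (k + 1) < 0 := by
      rw [hcast, hk] at hge
      exact not_le.1 hge
    have hpos := hmin k (by omega)
    refine Or.inr ⟨k, ?_, hlt, hpos⟩
    rw [Nat.one_le_iff_ne_zero]
    rintro rfl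
    -- The sign change cannot occur at k = 0, since G_x(1, 1) is the same for x = 0 and x = 1.
    have h3 := Q.rejoinReward_one_one_eq hα.le (zero_le_one' ℝ) le_rfl
    rw [e2] at hlt
    rw [e1] at hpos
    norm_num at hlt hpos
    linarith

end FeedbackQueue

theorem mainTheorem2 (Q : FeedbackQueue) (α v : ℝ) (hα : 0 ≤ α) :
    (Q.zHat α v 1 0 1 < 0 →
      {x : ℝ | Q.IsNashThreshold α v x} = {0}) ∧
    (Q.zHat α v 1 0 1 = 0 →
      Set.Icc (0 : ℝ) 1 ⊆ {x : ℝ | Q.IsNashThreshold α v x} ∧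
      (0 < α → {x : ℝ | Q.IsNashThreshold α v x} = Set.Icc (0 : ℝ) 1)) ∧
    (∀ m : ℕ, 1 ≤ m →
      Q.zHat α v (m + 1) m (m + 1) ≤ 0 → 0 ≤ Q.zHat α v m m m →
      Q.IsNashThreshold α v m ∧
      (0 < α → Q.q < 1 → Q.zHat α v 1 0 1 ≠ 0 →
        {x : ℝ | Q.IsNashThreshold α v x} = {(m : ℝ)})) ∧
    (∀ m : ℕ, 1 ≤ m →
      Q.zHat α v (m + 1) (m + 1) (m + 1) < 0 → 0 < Q.zHat α v (m + 1) m (m + 1) →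
      ∃ χ ∈ Set.Ioo (m : ℝ) (m + 1),
        {x ∈ Set.Ioo (m : ℝ) (m + 1) | Q.zHat α v (m + 1) x (m + 1) = 0} = {χ} ∧
        {x : ℝ | Q.IsNashThreshold α v x} = {χ}) ∧
    (0 < α → 0 < v →
      Q.zHat α v 1 0 1 < 0 ∨ Q.zHat α v 1 0 1 = 0 ∨
      (∃ m : ℕ, 1 ≤ m ∧ Q.zHat α v (m + 1) m (m + 1) ≤ 0 ∧ 0 ≤ Q.zHat α v m m m) ∨
      (∃ m : ℕ, 1 ≤ m ∧ Q.zHat α v (m + 1) (m + 1) (m + 1) < 0 ∧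
        0 < Q.zHat α v (m + 1) m (m + 1))) := by
  refine ⟨Q.setOf_isNashThreshold_eq_zero hα, fun h => ?_, fun m hm h1 h2 => ?_,
    fun m hm h1 h2 => Q.exists_unique_mixed hα hm h1 h2, fun hα hv => ?_⟩
  · have hsub : Set.Icc (0 : ℝ) 1 ⊆ {x : ℝ | Q.IsNashThreshold α v x} := fun x hx =>
      Q.isNashThreshold_of_zHat_one_eq_zero hα h hx.1 hx.2
    exact ⟨hsub, fun hα => Set.Subset.antisymm
      (fun x hx => ⟨hx.1, Q.le_one_of_isNashThreshold hα h hx⟩) hsub⟩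
  · have hNash := Q.isNashThreshold_nat hα hm h1 h2
    refine ⟨hNash, fun hα hq h0 => Set.eq_singleton_iff_unique_mem.2 ⟨hNash, fun x hx => ?_⟩⟩
    refine Q.eq_of_isNashThreshold hα (Q.nonneg_of_zHat_nonpos hα.le h1) hq (Or.inl ?_) hNash hx
    have h4 := Q.zHat_nat (v := v) hα (le_refl 1) le_rfl (by simp)
    rw [Nat.cast_one] at h4
    rwa [h4, sub_ne_zero] at h0
  · rcases lt_trichotomy (Q.zHat α v 1 0 1) 0 with h | h | h
    · exact Or.inl h
    · exact Or.inr (Or.inl h)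
    · exact Or.inr (Or.inr (Q.exists_case hα hv h))
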